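/- Let $[n]=\{1,\dots,n\}$. For labeled points $p_1,\dots,p_n$ in the plane in general position (distinct, no three collinear), the chirotope assigns to each triple $(i,j,k)\in[n]^3$ the orientation of $(p_i,p_j,p_k)$: $+1$ for counterclockwise, $-1$ for clockwise, and $0$ if $i,j,k$ are not pairwise distinct. More generally, a generalized configuration consists of $n$ labeled distinct points and an arrangement of pseudo-lines (graphs of continuous functions $\mathbb R\to\mathbb R$, any two of which meet in exactly one point and cross there) such that each pseudo-line contains exactly two of the points and each pair of points lies on a pseudo-line; its chirotope $\chi$ has $\chi(i,j,k)=+1$ or $-1$, for pairwise distinct $i,j,k$, according to whether $p_k$ lies to the left or to the right of the pseudo-line through $p_i,p_j$ directed from $p_i$ to $p_j$, and $\chi(i,j,k)=0$ otherwise. Identifying a chirotope with its negative, the classes of chirotopes of point sets are called order types and those of generalized configurations abstract order types. The (counterclockwise) radial system of a chirotope assigns to each $i\in[n]$ the cyclic permutation $R(i)$ of $[n]\setminus\{i\}$ in which the other points appear counterclockwise around $p_i$. Let $T(R)$ be the set of abstract order types that are represented by a chirotope with radial system $R$. An algorithm may access $R$ only through queries. A query is a triple test (in which cyclic order do $j,k,l$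 appear in $R(i)$?), a request for the index of $j$ in $R(i)$ read from a given element $s$ on, or a request for the element at a given position of $R(i)$ read from a given element $s$ on; queries may depend on the previous answers, and the computation between queries is unrestricted and free. Then determining $|T(R)|$ needs $\Omega(n)$ queries in the worst case: there are constants $c>0$ and $N$ such that for every $n\ge N$ and every deterministic algorithm that correctly outputs $|T(R)|$ for each radial system $R$ on $[n]$ of an order type (of a point set in general position), there is such a radial system $R$ on which the algorithm makes at least $c\,n$ queries. -/

import Mathlib

namespace RadialSystems

/-! ### Chirotopes and order types -/

/-- Orientation functions on triples of labels: `1` is counterclockwise, `-1` is clockwise. -/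
abbrev Chirotope (n : ℕ) : Type := Fin n → Fin n → Fin n → SignType

/-- Pairwise distinctness of three labels. -/
def Distinct3 {n : ℕ} (i j k : Fin n) : Prop := i ≠ j ∧ i ≠ k ∧ j ≠ k

/-- The chirotope of a labeled family of points in the plane: the sign of the determinant of
`(p j - p i, p k - p i)`. -/
noncomputable def pointChirotope {n : ℕ} (p : Fin n → ℝ × ℝ) : Chirotope n := fun i j k =>
  SignType.sign (((p j).1 - (p i).1) * ((p k).2 - (p i).2)
    - ((p j).2 - (p i).2) * ((p k).1 - (p i).1))

/-- Labeled point sets in general position: distinct points, no three of them collinear. -/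
def GeneralPosition {n : ℕ} (p : Fin n → ℝ × ℝ) : Prop :=
  Function.Injective p ∧ ∀ i j k, Distinct3 i j k → pointChirotope p i j k ≠ 0

/-- The graphs of `f` and `g` have exactly one common point, and they cross there. -/
def CrossOnce (f g : ℝ → ℝ) : Prop :=
  ∃ x, f x = g x ∧
    (((∀ y, y < x → f y < g y) ∧ (∀ y, x < y → g y < f y)) ∨
     ((∀ y, y < x → g y < f y) ∧ (∀ y, x < y → f y < g y)))

/-- The point `q` lies on the graph of `f`. -/
def OnCurve (q : ℝ × ℝ) (f : ℝ → ℝ) : Prop := f q.1 = q.2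

/-- A generalized configuration of `n` labeled points: distinct points together with an
arrangement of pseudo-lines (`x`-monotone curves, i.e. graphs of continuous functions `ℝ → ℝ`,
every two of which meet in exactly one point and cross there) such that each pseudo-line contains
exactly two of the points and each pair of points lies on a pseudo-line. -/
structure GeneralizedConfiguration (n : ℕ) where
  pt : Fin n → ℝ × ℝ
  lines : Set (ℝ → ℝ)
  pt_injective : Function.Injective pt
  continuous_of_mem : ∀ f ∈ lines, Continuous f
  crossOnce : ∀ f ∈ lines, ∀ g ∈ lines, f ≠ g → CrossOnce f g
  two_points : ∀ f ∈ lines, {i | OnCurve (pt i) f}.ncard = 2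
  exists_line : ∀ i j, i ≠ j → ∃ f ∈ lines, OnCurve (pt i) f ∧ OnCurve (pt j) f

/-- `χ` is the chirotope of the generalized configuration `C`. If the pseudo-line `f` through
`p i` and `p j` is directed from `p i` to `p j`, its left side is the side above `f` if `p i` is to
the left of `p j` in the plane, and the side below `f` otherwise. -/
def IsChirotopeOf {n : ℕ} (C : GeneralizedConfiguration n) (χ : Chirotope n) : Prop :=
  (∀ i j k, ¬ Distinct3 i j k → χ i j k = 0) ∧
  ∀ i j k, Distinct3 i j k → ∀ f ∈ C.lines, OnCurve (C.pt i) f → OnCurve (C.pt j) f →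
    χ i j k = SignType.sign ((C.pt j).1 - (C.pt i).1)
      * SignType.sign ((C.pt k).2 - f (C.pt k).1)

/-- Chirotopes of generalized configurations. -/
def IsAbstractChirotope {n : ℕ} (χ : Chirotope n) : Prop :=
  ∃ C : GeneralizedConfiguration n, IsChirotopeOf C χ

/-- Two chirotopes are equivalent if they are equal or negatives of each other. -/
def chirotopeSetoid (n : ℕ) : Setoid (Chirotope n) where
  r χ χ' := (∀ i j k, χ i j k = χ' i j k) ∨ (∀ i j k, χ i j k = -χ' i j k)
  iseqv :=
    { refl := fun _ => Or.inl fun _ _ _ => rfl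
      symm := by
        rintro χ χ' (h | h)
        · exact Or.inl fun i j k => (h i j k).symm
        · exact Or.inr fun i j k => by rw [h, neg_neg]
      trans := by
        rintro χ χ' χ'' (h | h) (h' | h')
        · exact Or.inl fun i j k => by rw [h, h']
        · exact Or.inr fun i j k => by rw [h, h']
        · exact Or.inr fun i j k => by rw [h, h']
        · exact Or.inl fun i j k => by rw [h, h', neg_neg] }

/-- Equivalence classes of orientation functions; (abstract) order types are the classes of
(abstract) chirotopes. -/
abbrev OrderType (n : ℕ) : Type := Quotient (chirotopeSetoid n)

/-! ### Radial systems -/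

/-- A system of permutations: `R i j` is the element that follows `j` in the rotation around `i`.
That `R i` is a cyclic permutation of the labels other than `i` is part of `IsRadialSystemOf`. -/
abbrev RotationSystem (n : ℕ) : Type := Fin n → Equiv.Perm (Fin n)

/-- The points `j, k, l` appear in this counterclockwise cyclic order around `i`: at most one of
the counterclockwise angles from `j` to `k`, from `k` to `l` and from `l` to `j`, seen from `i`,
exceeds a half-turn, so at least two of the triples `(i,j,k)`, `(i,k,l)`, `(i,l,j)` are oriented
counterclockwise. -/
def CcwAround {n : ℕ} (χ : Chirotope n) (i j k l : Fin n) : Prop :=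
  (χ i j k = 1 ∧ χ i k l = 1) ∨ (χ i k l = 1 ∧ χ i l j = 1) ∨ (χ i l j = 1 ∧ χ i j k = 1)

/-- The index of `j` in the linear order obtained from the cyclic permutation `σ` by starting
at `s`. -/
noncomputable def index {n : ℕ} (σ : Equiv.Perm (Fin n)) (s j : Fin n) : ℕ :=
  sInf {r : ℕ | (σ ^ r) s = j}

/-- `R` is the (counterclockwise) radial system of `χ`: for each `i`, `R i` is a cyclic permutation
of the labels other than `i`, and it lists them in counterclockwise order around `i`. -/
def IsRadialSystemOf {n : ℕ} (χ : Chirotope n) (R : RotationSystem n) : Prop :=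
  ∀ i, (R i).IsCycleOn {j | j ≠ i} ∧
    ∀ j k l, j ≠ i → k ≠ i → l ≠ i → Distinct3 j k l →
      (CcwAround χ i j k l ↔ index (R i) j k < index (R i) j l)

/-- `T(R)`: the set of abstract order types with radial system `R`. -/
def T {n : ℕ} (R : RotationSystem n) : Set (OrderType n) :=
  {τ | ∃ χ, IsAbstractChirotope χ ∧ IsRadialSystemOf χ R ∧ Quotient.mk (chirotopeSetoid n) χ = τ}

/-- `R` is the radial system of the order type of a labeled point set in general position. -/
def IsOrderTypeRadialSystem {n : ℕ} (R : RotationSystem n) : Prop :=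
  ∃ p : Fin n → ℝ × ℝ, GeneralPosition p ∧ IsRadialSystemOf (pointChirotope p) R

/-! ### Query algorithms -/

/-- The queries to a radial system: triple tests (in which cyclic order do `j, k, l` appear around
`i`?), queries for the index of `j` in the rotation around `i` read from `s` on, and queries for the
element at position `r` of the rotation around `i` read from `s` on. -/
inductive Query (n : ℕ) : Type
  | tripleTest (i j k l : Fin n) : Query n
  | indexOf (i s j : Fin n) : Query n
  | entryAt (i s : Fin n) (r : ℕ) : Query n

/-- The type of answers to a query. -/
def Query.Answer {n : ℕ} : Query n → Type
  | .tripleTest _ _ _ _ => Bool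
  | .indexOf _ _ _ => ℕ
  | .entryAt _ _ _ => Fin n

/-- The answer to a query on the system `R`. -/
noncomputable def Query.answer {n : ℕ} (R : RotationSystem n) : (q : Query n) → q.Answer
  | .tripleTest i j k l => decide (index (R i) j k < index (R i) j l)
  | .indexOf i s j => index (R i) s j
  | .entryAt i s r => (R i ^ r) s

/-- Deterministic query algorithms for inputs with `n` labels, as decision trees: an algorithm
either stops with an output or asks a query, chosen in terms of all previous answers, and continues
in a way that depends on the answer. No restriction is put on the computation between queries. -/
inductive Algorithm (n : ℕ) : Type
  | output (m : ℕ) : Algorithm n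
  | ask (q : Query n) (next : q.Answer → Algorithm n) : Algorithm n

/-- The output of an algorithm on the system `R`. -/
noncomputable def Algorithm.run {n : ℕ} (R : RotationSystem n) : Algorithm n → ℕ
  | .output m => m
  | .ask q next => (next (q.answer R)).run R

/-- The number of queries that an algorithm asks on the system `R`. -/
noncomputable def Algorithm.numQueries {n : ℕ} (R : RotationSystem n) : Algorithm n → ℕ
  | .output _ => 0
  | .ask q next => (next (q.answer R)).numQueries R + 1

/-- The algorithm determines `|T(R)|` for each radial system `R` of an order type on `n` labels. -/
def Algorithm.DeterminesCard {n : ℕ} (A : Algorithm n) : Prop :=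
  ∀ R : RotationSystem n, IsOrderTypeRadialSystem R → A.run R = (T R).ncard

end RadialSystems

/-!
Label the points so that `2h` and `2h + 1` are two close points at level `h ≥ 1` of a vertical
ladder, `0` lies far to its left and `1` far to its right. If the points at each level are joined by
a line that leaves `0` on its left and `1` on its right, then moving the line from `0` to `1` from
below the ladder to above it changes the abstract order type but not the radial system `R`, so
`|T(R)| ≥ 2`.

Now turn the pair at a single level `m ≥ 2` so that `0` lies on the other side of its line. Then
`0, 1, 2m + 1, 2m` are in convex position, and the cyclic orders determine the orientations of a
convex quadrilateral. This fixes the line from `0` to `1`, and the pair at level `1` fixes the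
remaining orientations, so `|T(R)| = 1`.

The two configurations differ only in orientations that involve both points at level `m`. Hence a
query distinguishes their radial systems only if a point at level `m` is among its labels or is its
answer. Each query involves at most four levels, so an algorithm has to ask linearly many of them.
-/

namespace RadialSystems

variable {n : ℕ}

/-! ### Alternating orientation functions -/

namespace Distinct3

theorem rot {i j k : Fin n} (h : Distinct3 i j k) : Distinct3 j k i :=
  ⟨h.2.2, h.1.symm, h.2.1.symm⟩

theorem swap {i j k : Fin n} (h : Distinct3 i j k) : Distinct3 j i k :=
  ⟨h.1.symm, h.2.2, h.2.1⟩

theorem induction {P : Fin n → Fin n → Fin n → Prop}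
    (rot : ∀ i j k, P i j k → P j k i) (swap : ∀ i j k, P i j k → P j i k)
    (sorted : ∀ i j k, i < j → j < k → P i j k) {i j k : Fin n} (h : Distinct3 i j k) :
    P i j k := by
  obtain ⟨hij, hik, hjk⟩ := h
  rcases hij.lt_or_gt with hij | hij <;> rcases hik.lt_or_gt with hik | hik <;>
    rcases hjk.lt_or_gt with hjk | hjk
  · exact sorted i j k hij hjk
  · exact rot k i j (swap i k j (sorted i k j hik hjk))
  · exact absurd (hij.trans hjk) hik.asymm
  · exact rot k i j (sorted k i j hik hij)
  · exact swap j i k (sorted j i k hij hik)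
  · exact absurd (hjk.trans hij) hik.asymm
  · exact rot k i j (rot j k i (sorted j k i hjk hik))
  · exact swap j i k (rot k j i (sorted k j i hjk hij))

end Distinct3

theorem eq_one_or_eq_neg_one_of_ne_zero {s : SignType} (h : s ≠ 0) : s = 1 ∨ s = -1 := by
  revert s; decide

theorem sign_sub_comm (x y : ℝ) : SignType.sign (x - y) = -SignType.sign (y - x) := by
  rw [← Left.sign_neg, neg_sub]

/-- Orientation functions that change sign under transpositions of their arguments. -/
structure IsAlternating (χ : Chirotope n) : Prop where
  rot : ∀ i j k, χ j k i = χ i j k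
  swap : ∀ i j k, χ j i k = -χ i j k

/-- Uniform alternating orientation functions: the alternating ones that vanish on degenerate
triples only, as chirotopes of points in general position do. -/
structure IsUniform (χ : Chirotope n) : Prop extends IsAlternating χ where
  ne_zero : ∀ i j k, Distinct3 i j k → χ i j k ≠ 0

namespace IsAlternating

variable {χ ψ : Chirotope n}

theorem neg (h : IsAlternating χ) : IsAlternating (-χ) where
  rot i j k := congrArg Neg.neg (h.rot i j k)
  swap i j k := congrArg Neg.neg (h.swap i j k)

theorem rev (h : IsAlternating χ) (i j k : Fin n) : χ i k j = -χ i j k := by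
  rw [h.rot j i k, h.swap i j k]

theorem eq_zero (h : IsAlternating χ) {i j k : Fin n} (hd : ¬ Distinct3 i j k) :
    χ i j k = 0 := by
  have self_neg : ∀ s : SignType, s = -s → s = 0 := by decide
  by_cases hij : i = j
  · subst hij
    exact self_neg _ (h.swap i i k)
  by_cases hjk : j = k
  · subst hjk
    exact self_neg _ (h.rev i j j)
  · obtain rfl : i = k := by
      by_contra hik
      exact hd ⟨hij, hik, hjk⟩
    rw [← h.rot]
    exact self_neg _ (h.rev j i i)

theorem distinct3 (h : IsAlternating χ) {i j k : Fin n} (hne : χ i j k ≠ 0) :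
    Distinct3 i j k := by
  by_contra hd
  exact hne (h.eq_zero hd)

theorem ext_of_sorted (h : IsAlternating χ) (h' : IsAlternating ψ)
    (hs : ∀ i j k, i < j → j < k → χ i j k = ψ i j k) : χ = ψ := by
  funext i j k
  by_cases hd : Distinct3 i j k
  · refine Distinct3.induction (P := fun i j k => χ i j k = ψ i j k) ?_ ?_ hs hd
    · intro i j k hijk
      rw [h.rot, h'.rot, hijk]
    · intro i j k hijk
      rw [h.swap, h'.swap, hijk]
  · rw [h.eq_zero hd, h'.eq_zero hd]

theorem isUniform_of_sorted (h : IsAlternating χ)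
    (hs : ∀ i j k, i < j → j < k → χ i j k ≠ 0) : IsUniform χ where
  toIsAlternating := h
  ne_zero i j k := by
    refine Distinct3.induction (P := fun i j k => χ i j k ≠ 0) ?_ ?_ hs
    · intro i j k hijk
      rwa [h.rot]
    · intro i j k hijk
      have neg_ne_zero : ∀ s : SignType, s ≠ 0 → -s ≠ 0 := by decide
      exact h.swap i j k ▸ neg_ne_zero _ hijk

end IsAlternating

/-- At least two of three signs are positive; this is the pattern in `CcwAround`. -/
abbrev TwoPositive (x y z : SignType) : Prop :=
  (x = 1 ∧ y = 1) ∨ (y = 1 ∧ z = 1) ∨ (z = 1 ∧ x = 1)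

theorem ccwAround_iff_twoPositive {χ : Chirotope n} {i j k l : Fin n} :
    CcwAround χ i j k l ↔ TwoPositive (χ i j k) (χ i k l) (χ i l j) :=
  Iff.rfl

namespace CcwAround

variable {χ : Chirotope n} {i j k l : Fin n}

theorem rot (h : CcwAround χ i j k l) : CcwAround χ i k l j :=
  Or.rotate h

theorem distinct3 (h : CcwAround χ i j k l) (hχ : IsAlternating χ) : Distinct3 j k l := by
  have no_two {s : SignType} : ¬ (s = 1 ∧ -s = 1) := by revert s; decide
  have zero_ne_one : (0 : SignType) ≠ 1 := by decide
  refine ⟨?_, ?_, ?_⟩ <;> rintro rfl <;>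
    simp only [CcwAround, hχ.eq_zero fun hd : Distinct3 i _ _ => hd.2.2 rfl, zero_ne_one,
      false_and, and_false, or_false, false_or] at h
  · exact no_two (hχ.rev i j l ▸ h)
  · exact no_two (hχ.rev i j k ▸ h)
  · exact no_two (hχ.rev i j k ▸ h.symm)

theorem ne (h : CcwAround χ i j k l) (hχ : IsAlternating χ) : j ≠ i ∧ k ≠ i ∧ l ≠ i := by
  have hd {a b : Fin n} (hab : χ i a b = 1) : Distinct3 i a b :=
    hχ.distinct3 (hab ▸ by decide)
  rcases h with ⟨h₁, h₂⟩ | ⟨h₁, h₂⟩ | ⟨h₁, h₂⟩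
  all_goals
    have := hd h₁
    have := hd h₂
    grind [Distinct3]

end CcwAround

theorem IsUniform.ccwAround_rev {χ : Chirotope n} (hχ : IsUniform χ) {i j k l : Fin n}
    (hj : j ≠ i) (hk : k ≠ i) (hl : l ≠ i) (hd : Distinct3 j k l) :
    CcwAround χ i l k j ↔ ¬ CcwAround χ i j k l := by
  have hx := hχ.ne_zero i j k ⟨hj.symm, hk.symm, hd.1⟩
  have hy := hχ.ne_zero i k l ⟨hk.symm, hl.symm, hd.2.2⟩
  have hz := hχ.ne_zero i l j ⟨hl.symm, hj.symm, hd.2.1.symm⟩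
  rw [ccwAround_iff_twoPositive, ccwAround_iff_twoPositive, hχ.rev i k l, hχ.rev i j k,
    hχ.rev i l j]
  generalize χ i j k = x, χ i k l = y, χ i l j = z at *
  revert x y z; decide

/-! ### Generalized configurations -/

theorem CrossOnce.exists_sign_sub {f g : ℝ → ℝ} (h : CrossOnce f g) {x : ℝ} (hx : f x = g x) :
    ∃ e : SignType, ∀ y, SignType.sign (f y - g y) = e * SignType.sign (y - x) := by
  obtain ⟨x', -, h⟩ := h
  obtain rfl : x' = x := by
    rcases lt_trichotomy x' x with hlt | heq | hgt
    · rcases h with h | h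
      · exact absurd hx (h.2 x hlt).ne'
      · exact absurd hx (h.2 x hlt).ne
    · exact heq
    · rcases h with h | h
      · exact absurd hx (h.1 x hgt).ne
      · exact absurd hx (h.1 x hgt).ne'
  rcases h with h | h
  · refine ⟨1, fun y => ?_⟩
    rcases lt_trichotomy y x' with hy | rfl | hy
    · rw [sign_neg (sub_neg.2 (h.1 y hy)), sign_neg (sub_neg.2 hy), one_mul]
    · simp [hx]
    · rw [sign_pos (sub_pos.2 (h.2 y hy)), sign_pos (sub_pos.2 hy), one_mul]
  · refine ⟨-1, fun y => ?_⟩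
    rcases lt_trichotomy y x' with hy | rfl | hy
    · rw [sign_pos (sub_pos.2 (h.1 y hy)), sign_neg (sub_neg.2 hy)]
      rfl
    · simp [hx]
    · rw [sign_neg (sub_neg.2 (h.2 y hy)), sign_pos (sub_pos.2 hy)]
      rfl

theorem CrossOnce.lt_iff_lt {f g : ℝ → ℝ} (h : CrossOnce f g) {x u v : ℝ} (hx : f x = g x)
    (hu : f u < g u) (hv : g v < f v) : u < x ↔ x < v := by
  obtain ⟨e, he⟩ := h.exists_sign_sub hx
  have hu' := he u
  have hv' := he v
  rw [sign_neg (sub_neg.2 hu)] at hu'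
  rw [sign_pos (sub_pos.2 hv)] at hv'
  rw [← sub_neg, ← sub_pos (a := v), ← sign_eq_neg_one_iff, ← sign_eq_one_iff]
  generalize SignType.sign (u - x) = s, SignType.sign (v - x) = t at *
  clear he
  revert e s t; decide

namespace GeneralizedConfiguration

variable (C : GeneralizedConfiguration n)

theorem not_onCurve {i j k : Fin n} (h : Distinct3 i j k) {f : ℝ → ℝ}
    (hf : f ∈ C.lines) (hi : OnCurve (C.pt i) f) (hj : OnCurve (C.pt j) f) :
    ¬ OnCurve (C.pt k) f := by
  intro hk
  have hsub : {i, j, k} ⊆ {i | OnCurve (C.pt i) f} := by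
    rintro x (rfl | rfl | rfl) <;> assumption
  have hcard : ({i, j, k} : Set (Fin n)).ncard = 3 :=
    Set.ncard_eq_three.2 ⟨i, j, k, h.1, h.2.1, h.2.2, rfl⟩
  have := Set.ncard_le_ncard hsub
  have := C.two_points f hf
  lia

theorem ne_of_onCurve {i j k : Fin n} (h : Distinct3 i j k) {f g : ℝ → ℝ}
    (hf : f ∈ C.lines) (hfi : OnCurve (C.pt i) f) (hfj : OnCurve (C.pt j) f)
    (hgk : OnCurve (C.pt k) g) : f ≠ g := by
  rintro rfl
  exact C.not_onCurve h hf hfi hfj hgk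

theorem fst_ne {i j : Fin n} (h : i ≠ j) : (C.pt i).1 ≠ (C.pt j).1 := by
  intro hx
  obtain ⟨f, -, hi, hj⟩ := C.exists_line i j h
  refine h (C.pt_injective (Prod.ext hx ?_))
  rw [← hi, ← hj, hx]

end GeneralizedConfiguration

namespace IsChirotopeOf

variable {C : GeneralizedConfiguration n} {χ : Chirotope n}

theorem apply_rot (h : IsChirotopeOf C χ) (i j k : Fin n) : χ j k i = χ i j k := by
  by_cases hd : Distinct3 i j k
  · obtain ⟨f, hf, hfi, hfj⟩ := C.exists_line i j hd.1
    obtain ⟨g, hg, hgj, hgk⟩ := C.exists_line j k hd.2.2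
    have hfg := C.crossOnce f hf g hg (C.ne_of_onCurve hd hf hfi hfj hgk)
    obtain ⟨e, he⟩ := hfg.exists_sign_sub (hfj.trans hgj.symm)
    have hei := he (C.pt i).1
    have hek := he (C.pt k).1
    rw [h.2 i j k hd f hf hfi hfj, h.2 j k i hd.rot g hg hgj hgk, ← hfi, ← hgk, hei,
      sign_sub_comm (g _), hek, sign_sub_comm (C.pt i).1]
    generalize SignType.sign ((C.pt k).1 - (C.pt j).1) = x
    generalize SignType.sign ((C.pt j).1 - (C.pt i).1) = y
    clear he hei hek
    revert x y e; decide
  · rw [h.1 i j k hd, h.1 j k i fun h' => hd h'.rot.rot]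

theorem isUniform (h : IsChirotopeOf C χ) : IsUniform χ where
  rot := h.apply_rot
  swap i j k := by
    by_cases hd : Distinct3 i j k
    · obtain ⟨f, hf, hfi, hfj⟩ := C.exists_line i j hd.1
      rw [h.2 i j k hd f hf hfi hfj, h.2 j i k hd.swap f hf hfj hfi, sign_sub_comm, neg_mul]
    · rw [h.1 i j k hd, h.1 j i k fun h' => hd h'.swap, neg_zero]
  ne_zero i j k hd := by
    obtain ⟨f, hf, hi, hj⟩ := C.exists_line i j hd.1
    rw [h.2 i j k hd f hf hi hj]
    refine mul_ne_zero ?_ ?_ <;> rw [sign_ne_zero, sub_ne_zero]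
    · exact C.fst_ne hd.1.symm
    · exact fun hk => C.not_onCurve hd hf hi hj hk.symm

theorem eq_sign_sub (h : IsChirotopeOf C χ) {i j : Fin n} (hij : (C.pt i).1 < (C.pt j).1)
    {f : ℝ → ℝ} (hf : f ∈ C.lines) (hi : OnCurve (C.pt i) f) (hj : OnCurve (C.pt j) f)
    (k : Fin n) : χ i j k = SignType.sign ((C.pt k).2 - f (C.pt k).1) := by
  have hne : i ≠ j := fun e => hij.ne (e ▸ rfl)
  by_cases hd : Distinct3 i j k
  · rw [h.2 i j k hd f hf hi hj, sign_pos (sub_pos.2 hij), one_mul]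
  · rw [h.1 i j k hd, eq_comm, sign_eq_zero_iff, sub_eq_zero]
    by_cases hik : i = k
    · exact hik ▸ hi.symm
    · have hjk : j = k := by
        by_contra hjk
        exact hd ⟨hne, hik, hjk⟩
      exact hjk ▸ hj.symm

theorem eq_one_iff (h : IsChirotopeOf C χ) {i j : Fin n} (hij : (C.pt i).1 < (C.pt j).1)
    {f : ℝ → ℝ} (hf : f ∈ C.lines) (hi : OnCurve (C.pt i) f) (hj : OnCurve (C.pt j) f)
    {k : Fin n} : χ i j k = 1 ↔ f (C.pt k).1 < (C.pt k).2 := by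
  rw [h.eq_sign_sub hij hf hi hj, sign_eq_one_iff, sub_pos]

theorem eq_neg_one_iff (h : IsChirotopeOf C χ) {i j : Fin n} (hij : (C.pt i).1 < (C.pt j).1)
    {f : ℝ → ℝ} (hf : f ∈ C.lines) (hi : OnCurve (C.pt i) f) (hj : OnCurve (C.pt j) f)
    {k : Fin n} : χ i j k = -1 ↔ (C.pt k).2 < f (C.pt k).1 := by
  rw [h.eq_sign_sub hij hf hi hj, sign_eq_neg_one_iff, sub_neg]

theorem ne_neg_one_of_leftmost (h : IsChirotopeOf C χ) {a b c d : Fin n}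
    (hab : (C.pt a).1 < (C.pt b).1) (hac : (C.pt a).1 < (C.pt c).1)
    (habd : χ a b d = 1) (hbcd : χ b c d = 1) (hcad : χ c a d = 1) : χ a b c ≠ -1 := by
  intro habc
  have hχ := h.isUniform
  have hd : Distinct3 a b c := hχ.distinct3 (habc ▸ by decide)
  obtain ⟨f, hf, hfa, hfb⟩ := C.exists_line a b hd.1
  obtain ⟨g, hg, hgb, hgc⟩ := C.exists_line b c hd.2.2
  obtain ⟨l, hl, hlc, hla⟩ := C.exists_line c a hd.2.1.symm
  have hfl := C.crossOnce f hf l hl (C.ne_of_onCurve hd hf hfa hfb hlc)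
  have hgl := C.crossOnce g hg l hl (C.ne_of_onCurve hd.rot hg hgb hgc hla)
  have hfg := C.crossOnce f hf g hg (C.ne_of_onCurve hd hf hfa hfb hgc)
  have hfd : f (C.pt d).1 < (C.pt d).2 := (h.eq_one_iff hab hf hfa hfb).1 habd
  have hdl : (C.pt d).2 < l (C.pt d).1 :=
    (h.eq_neg_one_iff hac hl hla hlc).1 (by rw [hχ.swap c a d, hcad])
  have hcf : l (C.pt c).1 < f (C.pt c).1 := by
    rw [hlc]
    exact (h.eq_neg_one_iff hab hf hfa hfb).1 habc
  have hda : (C.pt d).1 < (C.pt a).1 :=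
    (hfl.lt_iff_lt (hfa.trans hla.symm) (hfd.trans hdl) hcf).2 hac
  rcases (C.fst_ne hd.2.2).lt_or_gt with hbc | hcb
  · have hgd : g (C.pt d).1 < (C.pt d).2 := (h.eq_one_iff hbc hg hgb hgc).1 hbcd
    have hag : l (C.pt a).1 < g (C.pt a).1 := by
      rw [hla]
      exact (h.eq_neg_one_iff hbc hg hgb hgc).1 (by rw [hχ.rot, habc])
    exact hac.not_gt ((hgl.lt_iff_lt (hgc.trans hlc.symm) (hgd.trans hdl) hag).1 (hda.trans hac))
  · have hdg : (C.pt d).2 < g (C.pt d).1 :=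
      (h.eq_neg_one_iff hcb hg hgc hgb).1 (by rw [hχ.swap b c d, hbcd])
    have hga : g (C.pt a).1 < f (C.pt a).1 := by
      rw [hfa]
      exact (h.eq_one_iff hcb hg hgc hgb).1 (by rw [hχ.swap b c a, hχ.rot, habc]; rfl)
    exact hab.not_gt ((hfg.lt_iff_lt (hfb.trans hgb.symm) (hfd.trans hdg) hga).1 (hda.trans hab))

end IsChirotopeOf

/-- The acyclicity axiom: no point lies to the left of all three sides of a clockwise triangle. -/
def IsAcyclic (χ : Chirotope n) : Prop :=
  ∀ a b c d, χ a b d = 1 → χ b c d = 1 → χ c a d = 1 → χ a b c ≠ -1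

theorem IsChirotopeOf.isAcyclic {C : GeneralizedConfiguration n} {χ : Chirotope n}
    (h : IsChirotopeOf C χ) : IsAcyclic χ := by
  intro a b c d habd hbcd hcad habc
  have hχ := h.isUniform
  have hd : Distinct3 a b c := hχ.distinct3 (habc ▸ by decide)
  have hbca : χ b c a = -1 := by rw [hχ.rot, habc]
  have hcab : χ c a b = -1 := by rw [hχ.rot, hbca]
  rcases (C.fst_ne hd.1).lt_or_gt with hab | hba
  · rcases (C.fst_ne hd.2.1).lt_or_gt with hac | hca
    · exact h.ne_neg_one_of_leftmost hab hac habd hbcd hcad habc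
    · exact h.ne_neg_one_of_leftmost hca (hca.trans hab) hcad habd hbcd hcab
  · rcases (C.fst_ne hd.2.2).lt_or_gt with hbc | hcb
    · exact h.ne_neg_one_of_leftmost hbc hba hbcd hcad habd hbca
    · exact h.ne_neg_one_of_leftmost (hcb.trans hba) hcb hcad habd hbcd hcab

/-! ### Point sets -/

open Filter Topology

/-- Twice the signed area of the triangle `p q r`, so that `pointChirotope` is the sign of it. -/
def area (p q r : ℝ × ℝ) : ℝ :=
  (q.1 - p.1) * (r.2 - p.2) - (q.2 - p.2) * (r.1 - p.1)

theorem pointChirotope_eq_sign_area (p : Fin n → ℝ × ℝ) (i j k : Fin n) :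
    pointChirotope p i j k = SignType.sign (area (p i) (p j) (p k)) :=
  rfl

theorem area_rot (p q r : ℝ × ℝ) : area q r p = area p q r := by
  unfold area
  ring

theorem area_swap (p q r : ℝ × ℝ) : area q p r = -area p q r := by
  unfold area
  ring

theorem isAlternating_pointChirotope (p : Fin n → ℝ × ℝ) : IsAlternating (pointChirotope p) where
  rot i j k := by simp only [pointChirotope_eq_sign_area, area_rot (p i)]
  swap i j k := by simp only [pointChirotope_eq_sign_area, area_swap (p i), Left.sign_neg]

theorem GeneralPosition.isUniform {p : Fin n → ℝ × ℝ} (hp : GeneralPosition p) :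
    IsUniform (pointChirotope p) where
  toIsAlternating := isAlternating_pointChirotope p
  ne_zero := hp.2

theorem CrossOnce.symm {f g : ℝ → ℝ} (h : CrossOnce f g) : CrossOnce g f :=
  let ⟨x, hx, hcross⟩ := h
  ⟨x, hx.symm, hcross.symm⟩

theorem crossOnce_affine {a b c d : ℝ} (h : b ≠ d) :
    CrossOnce (fun x => a + b * x) (fun x => c + d * x) := by
  wlog hbd : b < d generalizing a b c d
  · exact (this h.symm (h.lt_or_gt.resolve_left hbd)).symm
  have sub_eq (y : ℝ) : (a + b * y) - (c + d * y) = (b - d) * (y - (c - a) / (b - d)) := by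
    have := sub_ne_zero.2 h
    field
  refine ⟨(c - a) / (b - d), ?_, Or.inr ⟨fun y hy => ?_, fun y hy => ?_⟩⟩
  · rw [← sub_eq_zero, sub_eq, sub_self, mul_zero]
  · rw [← sub_pos, sub_eq]
    exact mul_pos_of_neg_of_neg (sub_neg.2 hbd) (sub_neg.2 hy)
  · rw [← sub_neg, sub_eq]
    exact mul_neg_of_neg_of_pos (sub_neg.2 hbd) (sub_pos.2 hy)

theorem area_eq_mul_of_affine {a b : ℝ} {p q : ℝ × ℝ} (hp : OnCurve p fun x => a + b * x)
    (hq : OnCurve q fun x => a + b * x) (r : ℝ × ℝ) :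
    area p q r = (q.1 - p.1) * (r.2 - (a + b * r.1)) := by
  rw [area, ← hp, ← hq]
  ring

/-- The cross product of `q - p` and `s - r`; it vanishes when the lines `p q` and `r s` are
parallel. -/
def slopeDet (p q r s : ℝ × ℝ) : ℝ :=
  (q.1 - p.1) * (s.2 - r.2) - (q.2 - p.2) * (s.1 - r.1)

/-- Point sets whose connecting lines are the graphs of affine functions with pairwise distinct
slopes. As connecting lines with a common point are included, this entails general position. -/
structure HasGenericLines (p : Fin n → ℝ × ℝ) : Prop where
  fst_injective : Function.Injective fun i => (p i).1
  slopeDet_ne_zero : ∀ i j k l, i ≠ j → k ≠ l → ({i, j} : Set (Fin n)) ≠ {k, l} →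
    slopeDet (p i) (p j) (p k) (p l) ≠ 0

/-- The graphs of affine functions through at least two of the points. -/
def connectingLines (p : Fin n → ℝ × ℝ) : Set (ℝ → ℝ) :=
  {f | (∃ a b, f = fun x => a + b * x) ∧ ∃ i j, i ≠ j ∧ OnCurve (p i) f ∧ OnCurve (p j) f}

namespace HasGenericLines

variable {p : Fin n → ℝ × ℝ}

theorem area_ne_zero (hp : HasGenericLines p) {i j k : Fin n} (hd : Distinct3 i j k) :
    area (p i) (p j) (p k) ≠ 0 := by
  refine hp.slopeDet_ne_zero i j i k hd.1 hd.2.1 fun h => ?_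
  have : k ∈ ({i, j} : Set (Fin n)) := h ▸ Or.inr rfl
  exact this.elim hd.2.1.symm hd.2.2.symm

theorem crossOnce (hp : HasGenericLines p) {f g : ℝ → ℝ} (hf : f ∈ connectingLines p)
    (hg : g ∈ connectingLines p) (hne : f ≠ g) : CrossOnce f g := by
  obtain ⟨⟨a, b, rfl⟩, i, j, hij, hi, hj⟩ := hf
  obtain ⟨⟨c, d, rfl⟩, k, l, hkl, hk, hl⟩ := hg
  refine crossOnce_affine fun hbd => ?_
  subst hbd
  simp only [OnCurve] at hi hj hk hl
  by_cases h : ({i, j} : Set (Fin n)) = {k, l}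
  · have hac : a = c := by
      rcases (h ▸ Or.inl rfl : i ∈ ({k, l} : Set (Fin n))) with rfl | rfl <;> linarith
    exact hne (hac ▸ rfl)
  · refine hp.slopeDet_ne_zero i j k l hij hkl h ?_
    rw [slopeDet, ← hi, ← hj, ← hk, ← hl]
    ring

theorem ncard_onCurve (hp : HasGenericLines p) {f : ℝ → ℝ} (hf : f ∈ connectingLines p) :
    {i | OnCurve (p i) f}.ncard = 2 := by
  obtain ⟨⟨a, b, rfl⟩, i, j, hij, hi, hj⟩ := hf
  refine Set.ncard_eq_two.2 ⟨i, j, hij, Set.ext fun k => ⟨fun hk => ?_, ?_⟩⟩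
  · by_contra hk'
    obtain ⟨hki, hkj⟩ := not_or.1 hk'
    refine hp.area_ne_zero ⟨hij, Ne.symm hki, Ne.symm hkj⟩ ?_
    rw [area_eq_mul_of_affine hi hj, ← show _ = (p k).2 from hk, sub_self, mul_zero]
  · rintro (rfl | rfl) <;> assumption

theorem exists_connectingLine (hp : HasGenericLines p) {i j : Fin n} (hij : i ≠ j) :
    ∃ f ∈ connectingLines p, OnCurve (p i) f ∧ OnCurve (p j) f := by
  set b := ((p j).2 - (p i).2) / ((p j).1 - (p i).1)
  have hslope : b * ((p j).1 - (p i).1) = (p j).2 - (p i).2 :=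
    div_mul_cancel₀ _ (sub_ne_zero.2 (hp.fst_injective.ne hij.symm))
  have hi : OnCurve (p i) fun x => ((p i).2 - b * (p i).1) + b * x := by simp [OnCurve]
  have hj : OnCurve (p j) fun x => ((p i).2 - b * (p i).1) + b * x := by
    simp only [OnCurve]
    linarith
  exact ⟨_, ⟨⟨_, _, rfl⟩, i, j, hij, hi, hj⟩, hi, hj⟩

theorem isAbstractChirotope (hp : HasGenericLines p) : IsAbstractChirotope (pointChirotope p) := by
  let C : GeneralizedConfiguration n :=
    { pt := p
      lines := connectingLines p
      pt_injective := fun i j h => hp.fst_injective (congrArg Prod.fst h)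
      continuous_of_mem := by
        rintro f ⟨⟨a, b, rfl⟩, -⟩
        fun_prop
      crossOnce := fun f hf g hg => hp.crossOnce hf hg
      two_points := fun f => hp.ncard_onCurve
      exists_line := fun i j => hp.exists_connectingLine }
  refine ⟨C, fun i j k => (isAlternating_pointChirotope p).eq_zero, ?_⟩
  rintro i j k - f ⟨⟨a, b, rfl⟩, -⟩ hi hj
  rw [pointChirotope_eq_sign_area, area_eq_mul_of_affine (p := p i) (q := p j) hi hj, sign_mul]

end HasGenericLines

theorem eventually_sign_eq {f : ℝ → ℝ} {x : ℝ} (hf : ContinuousAt f x) (h : f x ≠ 0) :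
    ∀ᶠ y in 𝓝 x, SignType.sign (f y) = SignType.sign (f x) := by
  have hsign : ContinuousAt (fun y => SignType.sign (f y)) x :=
    (continuousAt_sign_of_ne_zero h).comp hf
  exact hsign.eventually_mem ((isOpen_discrete {_}).mem_nhds rfl)

open Polynomial in
theorem eventually_eval_ne_zero {P : ℝ[X]} (hP : P ≠ 0) (x : ℝ) :
    ∀ᶠ y in 𝓝[≠] x, P.eval y ≠ 0 :=
  nhdsNE_le_cofinite x (Polynomial.finite_setOfPred_isRoot hP).compl_mem_cofinite

open Polynomial in
theorem eventually_quadratic_ne_zero {a b c : ℝ} (h : b ≠ 0 ∨ c ≠ 0) :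
    ∀ᶠ e in 𝓝[≠] (0 : ℝ), a + b * e + c * e ^ 2 ≠ 0 := by
  have hP : C a + C b * X + C c * X ^ 2 ≠ 0 := by
    intro hP
    have hb : b = 0 := by simpa [coeff_C] using congrArg (coeff · 1) hP
    have hc : c = 0 := by simpa [coeff_C, coeff_X] using congrArg (coeff · 2) hP
    exact h.elim (· hb) (· hc)
  simpa using eventually_eval_ne_zero hP 0

/-- The point set `p` with its points moved by `e` times the points with parameters `t` on the
moment curve `x ↦ (x, x ^ 2)`. -/
def perturb (p : Fin n → ℝ × ℝ) (t : Fin n → ℝ) (e : ℝ) (i : Fin n) : ℝ × ℝ :=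
  ((p i).1 + e * t i, (p i).2 + e * t i ^ 2)

theorem GeneralPosition.eventually_pointChirotope_perturb {p : Fin n → ℝ × ℝ}
    (hp : GeneralPosition p) (t : Fin n → ℝ) :
    ∀ᶠ e in 𝓝 (0 : ℝ), pointChirotope (perturb p t e) = pointChirotope p := by
  have sorted (i j k : Fin n) (hij : i < j) (hjk : j < k) :
      ∀ᶠ e in 𝓝 (0 : ℝ), pointChirotope (perturb p t e) i j k = pointChirotope p i j k := by
    have hp₀ : perturb p t 0 = p := by simp [perturb, funext_iff]
    have hne : area (perturb p t 0 i) (perturb p t 0 j) (perturb p t 0 k) ≠ 0 := by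
      rw [hp₀, ← sign_ne_zero]
      exact hp.2 i j k ⟨hij.ne, (hij.trans hjk).ne, hjk.ne⟩
    have hcont : Continuous fun e =>
        area (perturb p t e i) (perturb p t e j) (perturb p t e k) := by
      unfold area perturb
      fun_prop
    filter_upwards [eventually_sign_eq hcont.continuousAt hne] with e he
    rw [pointChirotope_eq_sign_area, he, hp₀, pointChirotope_eq_sign_area]
  simp only [← eventually_all] at sorted
  filter_upwards [sorted] with e he
  exact (isAlternating_pointChirotope _).ext_of_sorted (isAlternating_pointChirotope p) he

theorem eventually_fst_perturb_injective (p : Fin n → ℝ × ℝ) {t : Fin n → ℝ}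
    (ht : Function.Injective t) :
    ∀ᶠ e in 𝓝[≠] (0 : ℝ), Function.Injective fun i => (perturb p t e i).1 := by
  have ne (i j : Fin n) (hij : i ≠ j) :
      ∀ᶠ e in 𝓝[≠] (0 : ℝ), (perturb p t e i).1 ≠ (perturb p t e j).1 := by
    have hquad := eventually_quadratic_ne_zero (a := (p i).1 - (p j).1) (b := t i - t j) (c := 0)
      (Or.inl (sub_ne_zero.2 (ht.ne hij)))
    filter_upwards [hquad] with e he
    rw [← sub_ne_zero]
    convert he using 1
    simp only [perturb]
    ring
  simp only [← eventually_all] at ne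
  filter_upwards [ne] with e he i j hij
  by_contra hne
  exact he i j hne hij

theorem eventually_slopeDet_perturb_ne_zero (p : Fin n → ℝ × ℝ) {t : Fin n → ℝ} {i j k l : Fin n}
    (hij : t i ≠ t j) (hkl : t k ≠ t l) (hsum : t i + t j ≠ t k + t l) :
    ∀ᶠ e in 𝓝[≠] (0 : ℝ),
      slopeDet (perturb p t e i) (perturb p t e j) (perturb p t e k) (perturb p t e l) ≠ 0 := by
  have hquad := eventually_quadratic_ne_zero
    (a := slopeDet (p i) (p j) (p k) (p l))
    (b := (t j - t i) * ((p l).2 - (p k).2) + ((p j).1 - (p i).1) * (t l ^ 2 - t k ^ 2)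
        - (t j ^ 2 - t i ^ 2) * ((p l).1 - (p k).1) - ((p j).2 - (p i).2) * (t l - t k))
    (c := (t j - t i) * (t l - t k) * ((t k + t l) - (t i + t j)))
    (Or.inr (mul_ne_zero (mul_ne_zero (sub_ne_zero.2 hij.symm) (sub_ne_zero.2 hkl.symm))
      (sub_ne_zero.2 hsum.symm)))
  filter_upwards [hquad] with e he
  convert he using 1
  simp only [perturb, slopeDet]
  ring

theorem pair_eq_pair_of_two_pow_add_eq {i j k l : Fin n} (hij : i ≠ j) (hkl : k ≠ l)
    (h : (2 : ℝ) ^ (i : ℕ) + 2 ^ (j : ℕ) = 2 ^ (k : ℕ) + 2 ^ (l : ℕ)) :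
    ({i, j} : Set (Fin n)) = {k, l} := by
  have sum_pair {a b : Fin n} (hab : a ≠ b) :
      ∑ x ∈ ({(a : ℕ), (b : ℕ)} : Finset ℕ), 2 ^ x = 2 ^ (a : ℕ) + 2 ^ (b : ℕ) :=
    Finset.sum_pair (Fin.val_ne_of_ne hab)
  have heq : ({(i : ℕ), (j : ℕ)} : Finset ℕ) = {(k : ℕ), (l : ℕ)} := by
    apply Finset.geomSum_injective le_rfl
    dsimp only
    rw [sum_pair hij, sum_pair hkl]
    exact_mod_cast h
  have himage : Fin.val '' {i, j} = Fin.val '' ({k, l} : Set (Fin n)) := by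
    simpa [Set.image_pair] using congrArg (fun s : Finset ℕ => (s : Set ℕ)) heq
  exact Fin.val_injective.image_injective himage

theorem GeneralPosition.isAbstractChirotope {p : Fin n → ℝ × ℝ} (hp : GeneralPosition p) :
    IsAbstractChirotope (pointChirotope p) := by
  let t : Fin n → ℝ := fun i => 2 ^ (i : ℕ)
  have ht : Function.Injective t :=
    (pow_right_injective₀ two_pos (by norm_num)).comp Fin.val_injective
  have hslope : ∀ᶠ e in 𝓝[≠] (0 : ℝ), ∀ i j k l, i ≠ j → k ≠ l →
      ({i, j} : Set (Fin n)) ≠ {k, l} →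
      slopeDet (perturb p t e i) (perturb p t e j) (perturb p t e k) (perturb p t e l) ≠ 0 := by
    simp only [eventually_all]
    intro i j k l hij hkl hne
    exact eventually_slopeDet_perturb_ne_zero p (ht.ne hij) (ht.ne hkl)
      fun h => hne (pair_eq_pair_of_two_pow_add_eq hij hkl h)
  obtain ⟨e, hfst, hslope, heq⟩ := ((eventually_fst_perturb_injective p ht).and
    (hslope.and ((hp.eventually_pointChirotope_perturb t).filter_mono nhdsWithin_le_nhds))).exists
  rw [← heq]
  exact HasGenericLines.isAbstractChirotope ⟨hfst, hslope⟩

/-! ### Existence of radial systems -/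

theorem sbtw_or_sbtw_of_ne {α : Type*} [CircularOrder α] {x y z : α} (hxy : x ≠ y) (hyz : y ≠ z)
    (hzx : z ≠ x) : sbtw x y z ∨ sbtw z y x := by
  by_contra! h
  rw [sbtw_iff_not_btw, sbtw_iff_not_btw, not_not, not_not] at h
  rcases h.2.antisymm h.1 with h | h | h
  exacts [hxy h, hyz h, hzx h]

/-- The linear order is obtained by cutting the circle at `s`. -/
theorem exists_linearOrder_sbtw {α : Type*} [CircularOrder α] (s : α) :
    ∃ _ : LinearOrder α, ∀ x y z : α, x < y → y < z → sbtw x y z := by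
  classical
  let cut (x y : α) : Prop := (x = s ∧ y ≠ s) ∨ sbtw s x y
  have : IsStrictTotalOrder α cut :=
    { irrefl := by
        rintro x (⟨hx, hx'⟩ | hx)
        · exact hx' hx
        · exact sbtw_irrefl_right hx
      trans := by
        rintro x y z (⟨rfl, hy⟩ | hxy) (⟨rfl, -⟩ | hyz)
        · exact absurd rfl hy
        · exact Or.inl ⟨rfl, fun h => sbtw_irrefl_left_right (h ▸ hyz)⟩
        · exact absurd hxy sbtw_irrefl_left_right
        · exact Or.inr (hxy.trans_right hyz)
      trichotomous := by
        intro x y hxy hyx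
        by_contra hne
        have hx : x ≠ s := fun h => hxy (Or.inl ⟨h, fun h' => hne (h.trans h'.symm)⟩)
        have hy : y ≠ s := fun h => hyx (Or.inl ⟨h, hx⟩)
        rcases sbtw_or_sbtw_of_ne hx.symm hne hy with h | h
        · exact hxy (Or.inr h)
        · exact hyx (Or.inr h.cyclic_right) }
  refine ⟨linearOrderOfSTO cut, fun x y z (hxy : cut x y) (hyz : cut y z) => ?_⟩
  rcases hxy with ⟨rfl, hy⟩ | hxy
  · exact hyz.resolve_left fun h => hy h.1
  · rcases hyz with ⟨rfl, -⟩ | hyz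
    · exact absurd hxy sbtw_irrefl_left_right
    · exact (hyz.cyclic_left.trans_right hxy.cyclic_right).cyclic_right

theorem exists_equiv_fin_sbtw_iff (α : Type*) [CircularOrder α] [Fintype α] :
    ∃ e : Fin (Fintype.card α) ≃ α, ∀ x y z, sbtw (e x) (e y) (e z) ↔ sbtw x y z := by
  rcases isEmpty_or_nonempty α with _ | ⟨⟨s⟩⟩
  · exact ⟨(Fintype.equivFin α).symm, fun x => isEmptyElim ((Fintype.equivFin α).symm x)⟩
  obtain ⟨_, sbtw_of_lt⟩ := exists_linearOrder_sbtw s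
  let e : Fin (Fintype.card α) ≃o α := Fintype.orderIsoFinOfCardEq α rfl
  have sbtw_of_fin {x y z : Fin (Fintype.card α)} (h : sbtw x y z) : sbtw (e x) (e y) (e z) := by
    rcases Fin.sbtw_iff.1 h with ⟨h₁, h₂⟩ | ⟨h₁, h₂⟩ | ⟨h₁, h₂⟩
    · exact sbtw_of_lt _ _ _ (e.lt_iff_lt.2 h₁) (e.lt_iff_lt.2 h₂)
    · exact (sbtw_of_lt _ _ _ (e.lt_iff_lt.2 h₁) (e.lt_iff_lt.2 h₂)).cyclic_right
    · exact (sbtw_of_lt _ _ _ (e.lt_iff_lt.2 h₁) (e.lt_iff_lt.2 h₂)).cyclic_left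
  refine ⟨e.toEquiv, fun x y z => ⟨fun h => ?_, sbtw_of_fin⟩⟩
  change sbtw (e x) (e y) (e z) at h
  have hxy : x ≠ y := by
    rintro rfl
    exact sbtw_irrefl_left h
  have hyz : y ≠ z := by
    rintro rfl
    exact sbtw_irrefl_right h
  have hzx : z ≠ x := by
    rintro rfl
    exact sbtw_irrefl_left_right h
  exact (sbtw_or_sbtw_of_ne hxy hyz hzx).resolve_right fun h' => h.not_sbtw (sbtw_of_fin h')

theorem index_pow_apply {σ : Equiv.Perm (Fin n)} {S : Finset (Fin n)} (hσ : σ.IsCycleOn S)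
    {s : Fin n} (hs : s ∈ S) {r : ℕ} (hr : r < S.card) : index σ s ((σ ^ r) s) = r := by
  have hmem : r ∈ {t : ℕ | (σ ^ t) s = (σ ^ r) s} := rfl
  have hpow : (σ ^ index σ s ((σ ^ r) s)) s = (σ ^ r) s := Nat.sInf_mem ⟨r, hmem⟩
  have hle : index σ s ((σ ^ r) s) ≤ r := Nat.sInf_le hmem
  have hmod := (hσ.pow_apply_eq_pow_apply hs).1 hpow
  rwa [Nat.ModEq, Nat.mod_eq_of_lt hr, Nat.mod_eq_of_lt (hle.trans_lt hr)] at hmod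

section FormPerm

variable {m : ℕ} {f : Fin m → Fin n}

theorem isCycleOn_formPerm_ofFn (hf : Function.Injective f) :
    (List.ofFn f).formPerm.IsCycleOn (Finset.univ.image f) := by
  convert (List.nodup_ofFn.2 hf).isCycleOn_formPerm
  ext a
  simp

theorem formPerm_ofFn_pow_apply (hf : Function.Injective f) (x r : Fin m) :
    ((List.ofFn f).formPerm ^ (r : ℕ)) (f x) = f (x + r) := by
  have h := List.formPerm_pow_apply_getElem (List.ofFn f) (List.nodup_ofFn.2 hf) r x (by simp)
  simpa [Fin.add_def] using h

theorem index_formPerm_ofFn (hf : Function.Injective f) (x y : Fin m) :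
    index (List.ofFn f).formPerm (f x) (f y) = (y - x : Fin m) := by
  have : NeZero m := ⟨fun h => (h ▸ x).elim0⟩
  have hcard : (Finset.univ.image f).card = m := by simp [Finset.card_image_of_injective _ hf]
  have hy : f y = ((List.ofFn f).formPerm ^ ((y - x : Fin m) : ℕ)) (f x) := by
    rw [formPerm_ofFn_pow_apply hf, add_sub_cancel]
  rw [hy]
  exact index_pow_apply (isCycleOn_formPerm_ofFn hf) (by simp) (by rw [hcard]; exact (y - x).isLt)

theorem val_sub_lt_val_sub_iff_sbtw {x y z : Fin m} (hd : Distinct3 x y z) :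
    (y - x : Fin m).val < (z - x : Fin m).val ↔ sbtw x y z := by
  have val_sub (a b : Fin m) : (a - b : Fin m).val = if b ≤ a then a.val - b else m + a - b := by
    split_ifs with h
    · exact Fin.sub_val_of_le h
    · exact Fin.coe_sub_iff_lt.2 (not_le.1 h)
  simp only [val_sub, Fin.sbtw_iff, Fin.lt_def, Fin.le_def]
  obtain ⟨hxy, hxz, hyz⟩ := hd
  split_ifs <;> lia

end FormPerm

theorem grassmannPlucker_area (o a b c d : ℝ × ℝ) :
    area o a b * area o d c = area o c a * area o b d + area o a d * area o b c := by
  simp only [area]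
  ring

theorem grassmannPlucker_pointChirotope (p : Fin n → ℝ × ℝ) (i a b c d : Fin n) (s : SignType)
    (h₁ : pointChirotope p i a b * pointChirotope p i d c = s)
    (h₂ : pointChirotope p i c a * pointChirotope p i b d = -s)
    (h₃ : pointChirotope p i a d * pointChirotope p i b c = -s) : s = 0 := by
  simp only [pointChirotope_eq_sign_area, ← sign_mul] at h₁ h₂ h₃
  rw [grassmannPlucker_area] at h₁
  generalize area (p i) (p c) (p a) * area (p i) (p b) (p d) = y at *
  generalize area (p i) (p a) (p d) * area (p i) (p b) (p c) = z at *
  rcases s with _ | _ | _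
  · rfl
  · have hy : 0 < y := sign_eq_one_iff.1 h₂
    have hz : 0 < z := sign_eq_one_iff.1 h₃
    exact absurd (sign_eq_neg_one_iff.1 h₁) (add_pos hy hz).not_gt
  · have hy : y < 0 := sign_eq_neg_one_iff.1 h₂
    have hz : z < 0 := sign_eq_neg_one_iff.1 h₃
    exact absurd (sign_eq_one_iff.1 h₁) (add_neg hy hz).not_gt

theorem twoPositive_trans {x y z u v w : SignType} (hu : u ≠ 0) (hv : v ≠ 0) (hz : z ≠ 0)
    (hs : ∀ s, x * v = s → z * w = -s → u * y = -s → s = 0) (hxyz : TwoPositive x y z)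
    (hwvy : TwoPositive w v (-y)) : TwoPositive u v z := by
  revert x y z u v w
  set_option synthInstance.maxSize 1000 in decide

theorem GeneralPosition.ccwAround_trans {p : Fin n → ℝ × ℝ} (hp : GeneralPosition p)
    {i a b c d : Fin n} (habc : CcwAround (pointChirotope p) i a b c)
    (hbdc : CcwAround (pointChirotope p) i b d c) : CcwAround (pointChirotope p) i a d c := by
  have hχ : IsUniform (pointChirotope p) := hp.isUniform
  obtain ⟨ha, hb, hc⟩ := habc.ne hχ.toIsAlternating
  obtain ⟨-, hd, -⟩ := hbdc.ne hχ.toIsAlternating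
  have hd_abc := habc.distinct3 hχ.toIsAlternating
  have hd_bdc := hbdc.distinct3 hχ.toIsAlternating
  have had : a ≠ d := by
    rintro rfl
    exact (hχ.ccwAround_rev hc hb ha hd_abc.swap.rot.rot).1 habc hbdc.rot.rot
  refine twoPositive_trans (hχ.ne_zero _ _ _ ⟨ha.symm, hd.symm, had⟩)
    (hχ.ne_zero _ _ _ ⟨hd.symm, hc.symm, hd_bdc.2.2⟩)
    (hχ.ne_zero _ _ _ ⟨hc.symm, ha.symm, hd_abc.2.1.symm⟩)
    (grassmannPlucker_pointChirotope p i a b c d) habc ?_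
  rw [← hχ.rev i b c]
  exact hbdc

/-- The points of a configuration in general position other than the `i`-th, circularly ordered by
their counterclockwise appearance around it. -/
noncomputable abbrev GeneralPosition.circularOrder {p : Fin n → ℝ × ℝ} (hp : GeneralPosition p)
    (i : Fin n) : CircularOrder {j // j ≠ i} where
  sbtw a b c := CcwAround (pointChirotope p) i a b c
  btw a b c := ¬ CcwAround (pointChirotope p) i c b a
  btw_refl a h := (h.distinct3 hp.isUniform.toIsAlternating).1 rfl
  btw_cyclic_left h h' := h h'.rot
  sbtw_trans_left := hp.ccwAround_trans
  sbtw_iff_btw_not_btw {a b c} := by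
    rw [not_not]
    refine ⟨fun h => ⟨fun h' => ?_, h⟩, And.right⟩
    exact (hp.isUniform.ccwAround_rev a.2 b.2 c.2 (h.distinct3 hp.isUniform.toIsAlternating)).1 h' h
  btw_antisymm {a b c} h h' := by
    by_contra! hne
    have hd : Distinct3 a.1 b.1 c.1 := ⟨by simpa [Subtype.ext_iff] using hne.1,
      by simpa [Subtype.ext_iff] using hne.2.2.symm, by simpa [Subtype.ext_iff] using hne.2.1⟩
    exact h ((hp.isUniform.ccwAround_rev a.2 b.2 c.2 hd).2 h')
  btw_total a b c := by
    by_contra! h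
    have hd := h.1.distinct3 hp.isUniform.toIsAlternating
    exact (hp.isUniform.ccwAround_rev c.2 b.2 a.2 hd).1 h.2 h.1

theorem GeneralPosition.exists_isRadialSystemOf {p : Fin n → ℝ × ℝ} (hp : GeneralPosition p) :
    ∃ R : RotationSystem n, IsRadialSystemOf (pointChirotope p) R := by
  suffices h : ∀ i : Fin n, ∃ σ : Equiv.Perm (Fin n), σ.IsCycleOn {j | j ≠ i} ∧
      ∀ j k l, j ≠ i → k ≠ i → l ≠ i → Distinct3 j k l →
        (CcwAround (pointChirotope p) i j k l ↔ index σ j k < index σ j l) by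
    choose R hR using h
    exact ⟨R, hR⟩
  intro i
  let _ := hp.circularOrder i
  obtain ⟨e, he⟩ := exists_equiv_fin_sbtw_iff {j // j ≠ i}
  have hinj : Function.Injective fun x => (e x : Fin n) := Subtype.val_injective.comp e.injective
  refine ⟨(List.ofFn fun x => (e x : Fin n)).formPerm, ?_, fun j k l hj hk hl hd => ?_⟩
  · convert isCycleOn_formPerm_ofFn hinj
    rw [Finset.coe_image, Finset.coe_univ, Set.image_univ]
    exact ((EquivLike.range_comp Subtype.val e).trans Subtype.range_coe).symm
  · obtain ⟨x, hx⟩ := e.surjective ⟨j, hj⟩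
    obtain ⟨y, hy⟩ := e.surjective ⟨k, hk⟩
    obtain ⟨z, hz⟩ := e.surjective ⟨l, hl⟩
    obtain rfl : (e x : Fin n) = j := congrArg Subtype.val hx
    obtain rfl : (e y : Fin n) = k := congrArg Subtype.val hy
    obtain rfl : (e z : Fin n) = l := congrArg Subtype.val hz
    rw [index_formPerm_ofFn hinj, index_formPerm_ofFn hinj, val_sub_lt_val_sub_iff_sbtw, ← he]
    · rfl
    · exact ⟨fun h => hd.1 (h ▸ rfl), fun h => hd.2.1 (h ▸ rfl), fun h => hd.2.2 (h ▸ rfl)⟩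

/-! ### Queries -/

section Index

variable {χ ψ : Chirotope n} {R S : RotationSystem n} {i s j : Fin n}

namespace IsRadialSystemOf

theorem isCycleOn_erase (hR : IsRadialSystemOf χ R) (i : Fin n) :
    (R i).IsCycleOn (Finset.univ.erase i) := by
  convert (hR i).1
  ext j
  simp

theorem pow_apply_self (hR : IsRadialSystemOf χ R) (i : Fin n) (r : ℕ) : (R i ^ r) i = i := by
  refine Equiv.Perm.pow_apply_eq_self_of_apply_eq_self ?_ r
  by_contra hne
  obtain ⟨j, hj, hji⟩ := (hR i).1.1.surjOn hne
  exact hj ((R i).injective hji)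

theorem pow_apply_eq_self_iff (hR : IsRadialSystemOf χ R) {r : ℕ} : (R i ^ r) s = i ↔ s = i := by
  conv_lhs => rhs; rw [← hR.pow_apply_self i r]
  exact (R i ^ r).injective.eq_iff

theorem index_eq_zero (hR : IsRadialSystemOf χ R) (hd : ¬ Distinct3 i s j) :
    index (R i) s j = 0 := by
  by_cases hsj : s = j
  · exact Nat.sInf_eq_zero.2 (Or.inl hsj)
  refine Nat.sInf_eq_zero.2 (Or.inr (Set.eq_empty_of_forall_notMem fun r (hr : _ = j) => ?_))
  refine hd ⟨?_, ?_, hsj⟩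
  · rintro rfl
    exact hsj ((hR.pow_apply_self i r).symm.trans hr)
  · rintro rfl
    exact hsj (hR.pow_apply_eq_self_iff.1 hr)

theorem exists_pow_apply_eq (hR : IsRadialSystemOf χ R) (hs : s ≠ i) (hj : j ≠ i) :
    ∃ r < (Finset.univ.erase i).card, (R i ^ r) s = j :=
  (hR.isCycleOn_erase i).exists_pow_eq (Finset.mem_erase.2 ⟨hs, Finset.mem_univ s⟩)
    (Finset.mem_erase.2 ⟨hj, Finset.mem_univ j⟩)

theorem index_pow_apply (hR : IsRadialSystemOf χ R) (hs : s ≠ i) {r : ℕ}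
    (hr : r < (Finset.univ.erase i).card) : index (R i) s ((R i ^ r) s) = r :=
  RadialSystems.index_pow_apply (hR.isCycleOn_erase i)
    (Finset.mem_erase.2 ⟨hs, Finset.mem_univ s⟩) hr

theorem pow_index_apply (hR : IsRadialSystemOf χ R) (hs : s ≠ i) (hj : j ≠ i) :
    (R i ^ index (R i) s j) s = j := by
  obtain ⟨r, hr, rfl⟩ := hR.exists_pow_apply_eq hs hj
  rw [hR.index_pow_apply hs hr]

theorem index_lt_card (hR : IsRadialSystemOf χ R) (hs : s ≠ i) (hj : j ≠ i) :
    index (R i) s j < (Finset.univ.erase i).card := by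
  obtain ⟨r, hr, rfl⟩ := hR.exists_pow_apply_eq hs hj
  rwa [hR.index_pow_apply hs hr]

theorem setOf_ccwAround_eq_image (hR : IsRadialSystemOf χ R) (hχ : IsAlternating χ)
    (hd : Distinct3 i s j) :
    {k | CcwAround χ i s k j} = (fun r => (R i ^ r) s) '' Set.Ioo 0 (index (R i) s j) := by
  obtain ⟨his, hij, hsj⟩ := hd
  ext k
  constructor
  · intro hk
    obtain ⟨-, hki, -⟩ := hk.ne hχ
    have hdk := hk.distinct3 hχ
    have hpow := hR.pow_index_apply his.symm hki
    refine ⟨index (R i) s k, ⟨Nat.pos_of_ne_zero fun h => ?_, ?_⟩, hpow⟩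
    · rw [h] at hpow
      exact hdk.1 hpow
    · exact ((hR i).2 s k j his.symm hki hij.symm hdk).1 hk
  · rintro ⟨r, ⟨hr₀, hr⟩, rfl⟩
    have hr_lt := hr.trans (hR.index_lt_card his.symm hij.symm)
    have hindex := hR.index_pow_apply his.symm hr_lt
    have hki : (R i ^ r) s ≠ i := fun h => his (hR.pow_apply_eq_self_iff.1 h).symm
    have hsk : s ≠ (R i ^ r) s := by
      intro h
      rw [← h, hR.index_eq_zero fun hd => hd.2.2 rfl] at hindex
      exact hr₀.ne hindex
    have hkj : (R i ^ r) s ≠ j := by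
      intro h
      rw [h] at hindex
      exact hr.ne' hindex
    exact ((hR i).2 s _ j his.symm hki hij.symm ⟨hsk, hsj, hkj⟩).2 (hindex.trans_lt hr)

theorem index_eq_ncard (hR : IsRadialSystemOf χ R) (hχ : IsAlternating χ) (hd : Distinct3 i s j) :
    index (R i) s j = {k | CcwAround χ i s k j}.ncard + 1 := by
  have his := hd.1.symm
  have hij := hd.2.1.symm
  have hpos : index (R i) s j ≠ 0 := fun h => hd.2.2 (by simpa [h] using hR.pow_index_apply his hij)
  have hinj : Set.InjOn (fun r => (R i ^ r) s) (Set.Ioo 0 (index (R i) s j)) := by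
    intro r hr t ht hrt
    have hlt := hR.index_lt_card his hij
    rw [← hR.index_pow_apply his (hr.2.trans hlt), ← hR.index_pow_apply his (ht.2.trans hlt)]
    exact congrArg _ hrt
  rw [hR.setOf_ccwAround_eq_image hχ hd, hinj.ncard_image, ← Finset.coe_Ioo,
    Set.ncard_coe_finset, Nat.card_Ioo]
  lia

end IsRadialSystemOf

/-- The orientation functions agree on all triples that do not contain both `y` and `z`. -/
def AgreeOff (χ ψ : Chirotope n) (y z : Fin n) : Prop :=
  ∀ i j k, (i ≠ y ∧ j ≠ y ∧ k ≠ y) ∨ (i ≠ z ∧ j ≠ z ∧ k ≠ z) → χ i j k = ψ i j k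

theorem IsAlternating.agreeOff_of_sorted (hχ : IsAlternating χ) (hψ : IsAlternating ψ)
    {y z : Fin n} (h : ∀ i j k, i < j → j < k →
      (i ≠ y ∧ j ≠ y ∧ k ≠ y) ∨ (i ≠ z ∧ j ≠ z ∧ k ≠ z) → χ i j k = ψ i j k) :
    AgreeOff χ ψ y z := by
  intro i j k
  by_cases hd : Distinct3 i j k
  · refine Distinct3.induction (P := fun i j k =>
      (i ≠ y ∧ j ≠ y ∧ k ≠ y) ∨ (i ≠ z ∧ j ≠ z ∧ k ≠ z) → χ i j k = ψ i j k) ?_ ?_ h hd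
    · intro i j k hijk hoff
      rw [hχ.rot, hψ.rot, hijk (by tauto)]
    · intro i j k hijk hoff
      rw [hχ.swap, hψ.swap, hijk (by tauto)]
  · exact fun _ => by rw [hχ.eq_zero hd, hψ.eq_zero hd]

namespace AgreeOff

variable {y z : Fin n}

theorem ccwAround_iff (h : AgreeOff χ ψ y z) {i j k l : Fin n}
    (hd : (i ≠ y ∧ j ≠ y ∧ k ≠ y ∧ l ≠ y) ∨ (i ≠ z ∧ j ≠ z ∧ k ≠ z ∧ l ≠ z)) :
    CcwAround χ i j k l ↔ CcwAround ψ i j k l := by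
  rw [CcwAround, CcwAround, h i j k (by tauto), h i k l (by tauto), h i l j (by tauto)]

theorem index_eq (h : AgreeOff χ ψ y z) (hyz : y ≠ z) (hχ : IsAlternating χ)
    (hψ : IsAlternating ψ) (hR : IsRadialSystemOf χ R) (hS : IsRadialSystemOf ψ S)
    (hi : i ≠ y ∧ i ≠ z) (hs : s ≠ y ∧ s ≠ z) (hj : j ≠ y ∧ j ≠ z) :
    index (R i) s j = index (S i) s j := by
  by_cases hd : Distinct3 i s j
  · have hccw (k : Fin n) : CcwAround χ i s k j ↔ CcwAround ψ i s k j := by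
      have hk : k ≠ y ∨ k ≠ z := by
        by_contra! hk
        exact hyz (hk.1.symm.trans hk.2)
      exact h.ccwAround_iff (by tauto)
    simp only [hR.index_eq_ncard hχ hd, hS.index_eq_ncard hψ hd, hccw]
  · rw [hR.index_eq_zero hd, hS.index_eq_zero hd]

theorem pow_apply_eq (h : AgreeOff χ ψ y z) (hyz : y ≠ z) (hχ : IsAlternating χ)
    (hψ : IsAlternating ψ) (hR : IsRadialSystemOf χ R) (hS : IsRadialSystemOf ψ S) {r : ℕ}
    (hi : i ≠ y ∧ i ≠ z) (hs : s ≠ y ∧ s ≠ z) (hj : (R i ^ r) s ≠ y ∧ (R i ^ r) s ≠ z) :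
    (R i ^ r) s = (S i ^ r) s := by
  by_cases hsi : s = i
  · subst hsi
    rw [hR.pow_apply_self, hS.pow_apply_self]
  have hji : (R i ^ r) s ≠ i := fun h => hsi (hR.pow_apply_eq_self_iff.1 h)
  have hmem : s ∈ Finset.univ.erase i := Finset.mem_erase.2 ⟨hsi, Finset.mem_univ s⟩
  have hmod : index (R i) s ((R i ^ r) s) ≡ r [MOD (Finset.univ.erase i).card] :=
    ((hR.isCycleOn_erase i).pow_apply_eq_pow_apply hmem).1 (hR.pow_index_apply hsi hji)
  rw [h.index_eq hyz hχ hψ hR hS hi hs hj] at hmod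
  rw [← ((hS.isCycleOn_erase i).pow_apply_eq_pow_apply hmem).2 hmod, hS.pow_index_apply hsi hji]

end AgreeOff

end Index

/-- The labels are grouped into the blocks `{2m, 2m+1}`; these are the blocks `m` that contain a
label of the query or the label that answers it on `R`. -/
def Query.touched (R : RotationSystem n) : Query n → Finset ℕ
  | .tripleTest i j k l => {i.val / 2, j.val / 2, k.val / 2, l.val / 2}
  | .indexOf i s j => {i.val / 2, s.val / 2, j.val / 2}
  | .entryAt i s r => {i.val / 2, s.val / 2, ((R i ^ r) s).val / 2}

theorem Query.card_touched_le_four (R : RotationSystem n) (q : Query n) :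
    (q.touched R).card ≤ 4 := by
  cases q with
  | tripleTest => exact Finset.card_le_four
  | indexOf | entryAt => exact Finset.card_le_three.trans (by decide)

theorem Query.answer_eq_of_agreeOff {χ ψ : Chirotope n} {R S : RotationSystem n} {y z : Fin n}
    {m : ℕ} (hy : y.val / 2 = m) (hz : z.val / 2 = m) (hyz : y ≠ z) (h : AgreeOff χ ψ y z)
    (hχ : IsAlternating χ) (hψ : IsAlternating ψ) (hR : IsRadialSystemOf χ R)
    (hS : IsRadialSystemOf ψ S) {q : Query n} (hq : m ∉ q.touched R) :
    q.answer R = q.answer S := by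
  have ne {i : Fin n} (hi : m ≠ i.val / 2) : i ≠ y ∧ i ≠ z := by
    constructor <;> rintro rfl
    exacts [hi hy.symm, hi hz.symm]
  cases q <;> simp only [touched, Finset.mem_insert, Finset.mem_singleton, not_or] at hq
  case tripleTest i j k l =>
    obtain ⟨hi, hj, hk, hl⟩ := hq
    exact congrArg₂ (fun a b : ℕ => decide (a < b))
      (h.index_eq hyz hχ hψ hR hS (ne hi) (ne hj) (ne hk))
      (h.index_eq hyz hχ hψ hR hS (ne hi) (ne hj) (ne hl))
  case indexOf i s j =>
    obtain ⟨hi, hs, hj⟩ := hq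
    exact h.index_eq hyz hχ hψ hR hS (ne hi) (ne hs) (ne hj)
  case entryAt i s r =>
    obtain ⟨hi, hs, hj⟩ := hq
    exact h.pow_apply_eq hyz hχ hψ hR hS (ne hi) (ne hs) (ne hj)

theorem Algorithm.card_le_four_mul_numQueries (A : Algorithm n) {R : RotationSystem n}
    {M : Finset ℕ} (hM : ∀ m ∈ M, ∃ S : RotationSystem n, A.run S ≠ A.run R ∧
      ∀ q : Query n, m ∉ q.touched R → q.answer R = q.answer S) :
    M.card ≤ 4 * A.numQueries R := by
  induction A generalizing M with
  | output k =>
    suffices h : M = ∅ by simp [h]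
    refine Finset.eq_empty_of_forall_notMem fun m hm => ?_
    obtain ⟨S, hS, -⟩ := hM m hm
    exact hS rfl
  | ask q next ih =>
    have hrest : (M \ q.touched R).card ≤ 4 * (next (q.answer R)).numQueries R := by
      refine ih _ fun m hm => ?_
      obtain ⟨hmM, hmq⟩ := Finset.mem_sdiff.1 hm
      obtain ⟨S, hS, hans⟩ := hM m hmM
      refine ⟨S, ?_, hans⟩
      rwa [run, run, ← hans q hmq] at hS
    calc M.card ≤ (M \ q.touched R).card + (q.touched R).card :=
          Finset.card_le_card_sdiff_add_card
      _ ≤ 4 * (next (q.answer R)).numQueries R + 4 :=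
          Nat.add_le_add hrest (q.card_touched_le_four R)

/-! ### Reconstruction from the radial system -/

/-- The two orientation functions induce the same cyclic orders around all labels. -/
def SameRadial (χ ψ : Chirotope n) : Prop :=
  ∀ i j k l, CcwAround χ i j k l ↔ CcwAround ψ i j k l

section Reconstruction

variable {χ ψ : Chirotope n} {R : RotationSystem n}

theorem IsRadialSystemOf.sameRadial (hχR : IsRadialSystemOf χ R) (hψR : IsRadialSystemOf ψ R)
    (hχ : IsAlternating χ) (hψ : IsAlternating ψ) : SameRadial χ ψ := by
  intro i j k l
  constructor <;> intro h
  · obtain ⟨hj, hk, hl⟩ := h.ne hχ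
    have hd := h.distinct3 hχ
    exact ((hψR i).2 j k l hj hk hl hd).2 (((hχR i).2 j k l hj hk hl hd).1 h)
  · obtain ⟨hj, hk, hl⟩ := h.ne hψ
    have hd := h.distinct3 hψ
    exact ((hχR i).2 j k l hj hk hl hd).2 (((hψR i).2 j k l hj hk hl hd).1 h)

namespace SameRadial

theorem isRadialSystemOf (h : SameRadial χ ψ) (hχ : IsRadialSystemOf χ R) :
    IsRadialSystemOf ψ R := by
  simpa only [IsRadialSystemOf, h _ _ _ _] using hχ

theorem neg (h : SameRadial χ ψ) (hχ : IsAlternating χ) (hψ : IsAlternating ψ) :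
    SameRadial (-χ) (-ψ) := by
  have ccwAround_neg {φ : Chirotope n} (hφ : IsAlternating φ) (i j k l : Fin n) :
      CcwAround (-φ) i j k l ↔ CcwAround φ i l k j := by
    rw [CcwAround, CcwAround, hφ.rev i k l, hφ.rev i j k, hφ.rev i l j]
    simp only [Pi.neg_apply]
    tauto
  intro i j k l
  rw [ccwAround_neg hχ, ccwAround_neg hψ]
  exact h i l k j

theorem eq_one_of_convex (h : SameRadial χ ψ) (hχ : IsAlternating χ) (hψ : IsAlternating ψ)
    {a b c d : Fin n} (habc : χ a b c = 1) (habd : χ a b d = 1) (hacd : χ a c d = 1)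
    (hbcd : χ b c d = 1) : ψ a b c = 1 ∧ ψ a b d = 1 ∧ ψ a c d = 1 ∧ ψ b c d = 1 := by
  have around_a := (h a b c d).1 (Or.inl ⟨habc, hacd⟩)
  have around_b := (h b c d a).1 (Or.inl ⟨hbcd, (hχ.rot a b d).trans habd⟩)
  have around_c := (h c d a b).1
    (Or.inl ⟨(hχ.rot a c d).trans hacd, (hχ.rot b c a).trans ((hχ.rot a b c).trans habc)⟩)
  have around_d := (h d a b c).1
    (Or.inl ⟨(hχ.rot b d a).trans ((hχ.rot a b d).trans habd), (hχ.rot c d b).trans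
      ((hχ.rot b c d).trans hbcd)⟩)
  rw [ccwAround_iff_twoPositive, hψ.rev a b d] at around_a
  rw [ccwAround_iff_twoPositive, hψ.rot a b d, hψ.swap a b c] at around_b
  rw [ccwAround_iff_twoPositive, hψ.rot a c d, hψ.rot b c a, hψ.rot a b c, hψ.swap b c d]
    at around_c
  rw [ccwAround_iff_twoPositive, hψ.rot b d a, hψ.rot a b d, hψ.rot c d b, hψ.rot b c d,
    hψ.rot a d c, hψ.rev a c d] at around_d
  generalize ψ a b c = x, ψ a b d = y, ψ a c d = z, ψ b c d = w at *
  clear * - around_a around_b around_c around_d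
  revert x y z w
  decide

theorem eq_neg_one_of_convex (h : SameRadial χ ψ) (hχ : IsAlternating χ) (hψ : IsAlternating ψ)
    {a b c d : Fin n} (habc : χ a b c = -1) (habd : χ a b d = -1) (hacd : χ a c d = -1)
    (hbcd : χ b c d = -1) : ψ a b c = -1 ∧ ψ a b d = -1 ∧ ψ a c d = -1 ∧ ψ b c d = -1 := by
  simpa only [Pi.neg_apply, neg_eq_iff_eq_neg] using
    (h.neg hχ hψ).eq_one_of_convex hχ.neg hψ.neg (congrArg Neg.neg habc) (congrArg Neg.neg habd)
      (congrArg Neg.neg hacd) (congrArg Neg.neg hbcd)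

theorem eq_one_of_mem_triangle (h : SameRadial χ ψ) (hχ : IsAlternating χ)
    (hψ : IsAlternating ψ) {a b c d : Fin n} (habd : χ a b d = 1) (hbcd : χ b c d = 1)
    (hcad : χ c a d = 1) (habc : ψ a b c = 1) : ψ a b d = 1 ∧ ψ b c d = 1 ∧ ψ c a d = 1 := by
  have around_a := (h a b d c).1 (Or.inl ⟨habd, (hχ.rot c a d).trans hcad⟩)
  have around_b := (h b c d a).1 (Or.inl ⟨hbcd, (hχ.rot a b d).trans habd⟩)
  rw [ccwAround_iff_twoPositive, hψ.rot c a d, hψ.rev a b c, habc] at around_a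
  rw [ccwAround_iff_twoPositive, hψ.rot a b d, hψ.swap a b c, habc] at around_b
  generalize ψ a b d = x, ψ b c d = y, ψ c a d = z at *
  clear * - around_a around_b
  revert x y z
  decide

end SameRadial

end Reconstruction

/-! ### Ladders -/

/-- The orientation functions of the lower bound. The labels `2h, 2h+1` with `h ≥ 1` are two close
points at level `h`; label `0` lies to the left and label `1` to the right of all connecting lines
of points at different levels. The line from `0` to `1` passes below (`s = 1`) or above (`s = -1`)
all other points, and `0` lies to the left (`ε h = 1`) or to the right (`ε h = -1`) of the
connecting line of the two points at level `h`. -/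
structure IsLadder (χ : Chirotope n) (s : SignType) (ε : ℕ → SignType) : Prop
    extends IsAlternating χ where
  base : ∀ {a b u : Fin n}, a.val = 0 → b.val = 1 → 2 ≤ u.val → χ a b u = s
  left_level : ∀ {a u v : Fin n}, a.val = 0 → 2 ≤ u.val → u.val / 2 < v.val / 2 → χ a u v = 1
  left_twin : ∀ {a u v : Fin n}, a.val = 0 → 2 ≤ u.val → u < v → u.val / 2 = v.val / 2 →
    χ a u v = ε (u.val / 2)
  right : ∀ {b u v : Fin n}, b.val = 1 → 2 ≤ u.val → u < v → χ b u v = -1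
  twin : ∀ {u v w : Fin n}, 2 ≤ u.val → u < v → v < w → u.val / 2 = v.val / 2 → χ u v w = 1
  level : ∀ {u v w : Fin n}, 2 ≤ u.val → u.val / 2 < v.val / 2 → v < w → χ u v w = -1

/-- The values of a ladder on increasing triples. -/
def ladderSign (s : SignType) (ε : ℕ → SignType) (i j k : ℕ) : SignType :=
  if i = 0 then
    if j = 1 then s else if j / 2 = k / 2 then ε (j / 2) else 1
  else if i = 1 then -1
  else if i / 2 = j / 2 then 1 else -1

theorem IsAlternating.isLadder_of_sorted {χ : Chirotope n} {s : SignType} {ε : ℕ → SignType}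
    (hχ : IsAlternating χ)
    (h : ∀ i j k, i < j → j < k → χ i j k = ladderSign s ε i j k) :
    IsLadder χ s ε where
  toIsAlternating := hχ
  base {a b u} ha hb hu := by rw [h _ _ _ (by lia) (by lia)]; simp [ladderSign, ha, hb]
  left_level {a u v} ha hu huv := by
    rw [h _ _ _ (by lia) (by lia), ladderSign, if_pos ha, if_neg (by lia), if_neg huv.ne]
  left_twin {a u v} ha hu huv hl := by
    rw [h _ _ _ (by lia) huv, ladderSign, if_pos ha, if_neg (by lia), if_pos hl]
  right {b u v} hb hu huv := by
    rw [h _ _ _ (by lia) huv, ladderSign, if_neg (by lia), if_pos hb]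
  twin {u v w} hu huv hvw hl := by
    rw [h _ _ _ huv hvw, ladderSign, if_neg (by lia), if_neg (by lia), if_pos hl]
  level {u v w} hu huv hvw := by
    rw [h _ _ _ (by lia) hvw, ladderSign, if_neg (by lia), if_neg (by lia), if_neg huv.ne]

namespace IsLadder

variable {χ ψ : Chirotope n} {s t : SignType} {ε δ : ℕ → SignType}

theorem apply_of_lt (h : IsLadder χ s ε) {i j k : Fin n} (hij : i < j) (hjk : j < k) :
    χ i j k = ladderSign s ε i j k := by
  unfold ladderSign
  split_ifs with hi₀ hj hjk' hi₁ hij'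
  · exact h.base hi₀ hj (by lia)
  · exact h.left_twin hi₀ (by lia) hjk hjk'
  · exact h.left_level hi₀ (by lia) (by lia)
  · exact h.right hi₁ (by lia) hjk
  · exact h.twin (by lia) hij hjk hij'
  · exact h.level (by lia) (by lia) hjk

theorem isUniform (h : IsLadder χ s ε) (hs : s ≠ 0) (hε : ∀ l, ε l ≠ 0) : IsUniform χ := by
  refine h.isUniform_of_sorted fun i j k hij hjk => ?_
  rw [h.apply_of_lt hij hjk, ladderSign]
  have one_ne_zero : (1 : SignType) ≠ 0 ∧ (-1 : SignType) ≠ 0 := by decide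
  split_ifs
  exacts [hs, hε _, one_ne_zero.1, one_ne_zero.2, one_ne_zero.1, one_ne_zero.2]

theorem unique (h : IsLadder χ s ε) (h' : IsLadder ψ s ε) : χ = ψ :=
  h.ext_of_sorted h'.toIsAlternating fun i j k hij hjk => by
    rw [h.apply_of_lt hij hjk, h'.apply_of_lt hij hjk]

theorem agreeOff_base (h : IsLadder χ s ε) (h' : IsLadder ψ t ε) {a b : Fin n} (ha : a.val = 0)
    (hb : b.val = 1) : AgreeOff χ ψ a b := by
  refine h.agreeOff_of_sorted h'.toIsAlternating fun i j k hij hjk hd => ?_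
  rw [h.apply_of_lt hij hjk, h'.apply_of_lt hij hjk]
  unfold ladderSign
  split_ifs with hi hj <;> first | rfl | lia

theorem agreeOff_twin (h : IsLadder χ s ε) (h' : IsLadder ψ s δ) {m : ℕ}
    (hεδ : ∀ l, l ≠ m → ε l = δ l) {y z : Fin n} (hy : y.val = 2 * m) (hz : z.val = 2 * m + 1) :
    AgreeOff χ ψ y z := by
  refine h.agreeOff_of_sorted h'.toIsAlternating fun i j k hij hjk hd => ?_
  rw [h.apply_of_lt hij hjk, h'.apply_of_lt hij hjk]
  unfold ladderSign
  split_ifs with hi hj hjk' <;> first | rfl | exact hεδ _ (by lia)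

end IsLadder

/-! ### Ladders determined by their radial systems -/

theorem exists_level_ne (hn : 8 ≤ n) (k l : ℕ) :
    ∃ w : Fin n, 2 ≤ w.val ∧ w.val / 2 ≠ k ∧ w.val / 2 ≠ l := by
  obtain ⟨m, hm, hmkl⟩ : ∃ m ∈ Finset.Icc 1 3, m ∉ ({k, l} : Finset ℕ) :=
    Finset.exists_mem_notMem_of_card_lt_card (Finset.card_le_two.trans_lt (by decide))
  simp only [Finset.mem_Icc, Finset.mem_insert, Finset.mem_singleton, not_or] at hm hmkl
  refine ⟨⟨2 * m, by lia⟩, by lia, ?_, ?_⟩ <;> simpa using by lia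

namespace IsLadder

variable {χ ψ : Chirotope n} {s : SignType} {ε : ℕ → SignType} {a b u v w : Fin n}

section SameRadial

variable (h : IsLadder χ s ε) (hψ : IsAlternating ψ) (hR : SameRadial χ ψ)
include h hψ hR

theorem right_level_of_sameRadial (hb : b.val = 1) (hu : 2 ≤ u.val) (huv : u.val / 2 < v.val / 2)
    (hvw : v < w) : ψ b u v = -1 ∧ ψ b u w = -1 ∧ ψ b v w = -1 ∧ ψ u v w = -1 :=
  hR.eq_neg_one_of_convex h.toIsAlternating hψ (h.right hb hu (by lia)) (h.right hb hu (by lia))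
    (h.right hb (by lia) hvw) (h.level hu huv hvw)

theorem right_of_sameRadial_of_level_lt (hn : 8 ≤ n) (hb : b.val = 1) (hu : 2 ≤ u.val)
    (huv : u.val / 2 < v.val / 2) : ψ b u v = -1 := by
  obtain ⟨w, hw, hwu, hwv⟩ := exists_level_ne hn (u.val / 2) (v.val / 2)
  rcases hwu.lt_or_gt with hwu | hwu
  · exact (h.right_level_of_sameRadial hψ hR hb hw hwu (by lia)).2.2.1
  rcases hwv.lt_or_gt with hwv | hwv
  · exact (h.right_level_of_sameRadial hψ hR hb hu hwu (by lia)).2.1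
  · exact (h.right_level_of_sameRadial hψ hR hb hu huv (w := w) (by lia)).1

theorem twin_of_sameRadial (hn : 8 ≤ n) (hb : b.val = 1) (hu : 2 ≤ u.val) (huv : u < v)
    (hvw : v < w) (hl : u.val / 2 = v.val / 2) : ψ u v w = 1 ∧ ψ b u v = -1 := by
  have hbuw := h.right_of_sameRadial_of_level_lt hψ hR hn hb hu (v := w) (by lia)
  obtain ⟨-, hwuv, hubv⟩ := hR.eq_one_of_mem_triangle h.toIsAlternating hψ
    (a := b) (b := w) (c := u) (d := v)
    (by rw [h.rev, h.right hb (by lia) hvw, neg_neg])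
    (by rw [h.rot v, h.rot u, h.twin hu huv hvw hl])
    (by rw [h.swap, h.right hb hu huv, neg_neg])
    (by rw [hψ.rev, hbuw, neg_neg])
  rw [hψ.rot v, hψ.rot u] at hwuv
  rw [hψ.swap] at hubv
  exact ⟨hwuv, neg_eq_iff_eq_neg.1 hubv⟩

theorem right_of_sameRadial (hn : 8 ≤ n) (hb : b.val = 1) (hu : 2 ≤ u.val) (huv : u < v) :
    ψ b u v = -1 := by
  by_cases hl : u.val / 2 = v.val / 2
  · by_cases hu₁ : u.val / 2 = 1
    · obtain ⟨w, hw⟩ : ∃ w : Fin n, w.val = 4 := ⟨⟨4, by lia⟩, rfl⟩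
      exact (h.twin_of_sameRadial hψ hR hn hb hu huv (w := w) (by lia) hl).2
    · obtain ⟨w, hw⟩ : ∃ w : Fin n, w.val = 2 := ⟨⟨2, by lia⟩, rfl⟩
      exact (h.right_level_of_sameRadial hψ hR hb (u := w) (by lia) (by lia) huv).2.2.1
  · exact h.right_of_sameRadial_of_level_lt hψ hR hn hb hu (by lia)

theorem left_of_twin_of_sameRadial (ha : a.val = 0) (hu : 2 ≤ u.val) (huv : u < v)
    (hl : u.val / 2 = v.val / 2) (hvw : v < w) (hε : ε (u.val / 2) = 1) :
    ψ a u v = 1 ∧ ψ a u w = 1 ∧ ψ a v w = 1 := by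
  obtain ⟨hauv, hauw, havw, -⟩ := hR.eq_one_of_convex h.toIsAlternating hψ
    ((h.left_twin ha hu huv hl).trans hε) (h.left_level ha hu (by lia))
    (h.left_level ha (by lia) (by lia)) (h.twin hu huv hvw hl)
  exact ⟨hauv, hauw, havw⟩

theorem left_of_sameRadial_of_two_le_level (hε : ε 1 = 1) (ha : a.val = 0)
    (hu : 2 ≤ u.val / 2) (huv : u < v) (hauv : χ a u v = 1) : ψ a u v = 1 := by
  obtain ⟨x, hx⟩ : ∃ x : Fin n, x.val = 2 := ⟨⟨2, by lia⟩, rfl⟩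
  obtain ⟨x', hx'⟩ : ∃ x' : Fin n, x'.val = 3 := ⟨⟨3, by lia⟩, rfl⟩
  have haxv := (h.left_of_twin_of_sameRadial hψ hR ha (u := x) (v := x') (w := v)
    (by lia) (by lia) (by lia) (by lia) (by rwa [hx])).2.1
  have hvau := (hR.eq_one_of_mem_triangle h.toIsAlternating hψ (a := a) (b := x) (c := v) (d := u)
    (h.left_level ha (by lia) (by lia))
    (by rw [h.rev, h.level (by lia) (by lia) huv, neg_neg])
    (by rw [h.rot u, h.rot a, hauv]) haxv).2.2
  rwa [hψ.rot u, hψ.rot a] at hvau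

theorem left_level_of_sameRadial (hε : ε 1 = 1) (ha : a.val = 0) (hu : 2 ≤ u.val)
    (huv : u.val / 2 < v.val / 2) : ψ a u v = 1 := by
  by_cases hu₂ : 2 ≤ u.val / 2
  · exact h.left_of_sameRadial_of_two_le_level hψ hR hε ha hu₂ (by lia) (h.left_level ha hu huv)
  obtain ⟨x, hx⟩ : ∃ x : Fin n, x.val = 2 := ⟨⟨2, by lia⟩, rfl⟩
  obtain ⟨x', hx'⟩ : ∃ x' : Fin n, x'.val = 3 := ⟨⟨3, by lia⟩, rfl⟩
  obtain ⟨-, haxv, hax'v⟩ := h.left_of_twin_of_sameRadial hψ hR ha (u := x) (v := x') (w := v)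
    (by lia) (by lia) (by lia) (by lia) (by rwa [hx])
  obtain rfl | rfl : u = x ∨ u = x' := by lia
  exacts [haxv, hax'v]

theorem left_twin_of_sameRadial (hn : 5 ≤ n) (hε : ε 1 = 1) (ha : a.val = 0) (hu : 2 ≤ u.val)
    (huv : u < v) (hl : u.val / 2 = v.val / 2) (hεu : ε (u.val / 2) = 1) : ψ a u v = 1 := by
  by_cases hu₂ : 2 ≤ u.val / 2
  · exact h.left_of_sameRadial_of_two_le_level hψ hR hε ha hu₂ huv
      ((h.left_twin ha hu huv hl).trans hεu)
  · obtain ⟨w, hw⟩ : ∃ w : Fin n, w.val = 4 := ⟨⟨4, by lia⟩, rfl⟩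
    exact (h.left_of_twin_of_sameRadial hψ hR ha hu huv hl (w := w) (by lia) hεu).1

end SameRadial

section Reconstruction

variable (h : IsLadder χ 1 ε) (hR : SameRadial χ ψ)
include h hR

theorem twisted_twin_of_sameRadial (hψ : IsAlternating ψ) (ha : a.val = 0) (hb : b.val = 1)
    (hu : 2 ≤ u.val) (huv : u < v) (hl : u.val / 2 = v.val / 2) (hε : ε (u.val / 2) = -1) :
    ψ a b u = 1 ∧ ψ a b v = 1 ∧ ψ a u v = -1 := by
  obtain ⟨habv, habu, havu, -⟩ := hR.eq_one_of_convex h.toIsAlternating hψ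
    (a := a) (b := b) (c := v) (d := u) (h.base ha hb (by lia)) (h.base ha hb hu)
    (by rw [h.rev, h.left_twin ha hu huv hl, hε, neg_neg])
    (by rw [h.rev, h.right hb hu huv, neg_neg])
  rw [hψ.rev] at havu
  exact ⟨habu, habv, neg_eq_iff_eq_neg.1 havu⟩

variable (hn : 8 ≤ n) (hψ : IsUniform ψ) (hacyclic : IsAcyclic ψ) (hε₁ : ε 1 = 1) {m : ℕ}
  (hm : 1 ≤ m) (hmn : 2 * m + 1 < n) (hεm : ε m = -1)
include hn hψ hacyclic hε₁ hm hmn hεm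

theorem base_of_sameRadial (ha : a.val = 0) (hb : b.val = 1) (hu : 2 ≤ u.val) : ψ a b u = 1 := by
  obtain ⟨y, hy⟩ : ∃ y : Fin n, y.val = 2 * m := ⟨⟨2 * m, by lia⟩, rfl⟩
  obtain ⟨z, hz⟩ : ∃ z : Fin n, z.val = 2 * m + 1 := ⟨⟨2 * m + 1, hmn⟩, rfl⟩
  obtain ⟨haby, habz, -⟩ := h.twisted_twin_of_sameRadial hR hψ.toIsAlternating ha hb
    (u := y) (v := z) (by lia) (by lia) (by lia) (by rwa [show y.val / 2 = m by lia])
  rcases lt_trichotomy (u.val / 2) m with hum | hum | hum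
  · exact (hR.eq_one_of_mem_triangle h.toIsAlternating hψ.toIsAlternating
      (a := a) (b := b) (c := y) (d := u) (h.base ha hb hu)
      (by rw [h.rev, h.right hb hu (by lia), neg_neg])
      (by rw [h.rot u, h.rot a, h.left_level ha hu (by lia)]) haby).1
  · obtain rfl | rfl : u = y ∨ u = z := by lia
    exacts [haby, habz]
  · refine (eq_one_or_eq_neg_one_of_ne_zero (hψ.ne_zero a b u ?_)).resolve_right
      (hacyclic a b u y haby ?_ ?_)
    · exact ⟨by lia, by lia, by lia⟩
    · rw [hψ.rev, h.right_of_sameRadial hψ.toIsAlternating hR hn hb (by lia) (by lia), neg_neg]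
    · rw [hψ.rot y, hψ.rot a]
      exact h.left_level_of_sameRadial hψ.toIsAlternating hR hε₁ ha (by lia) (by lia)

theorem eq_of_sameRadial (hε : ∀ l, ε l ≠ 0) : ψ = χ := by
  have hb : (⟨1, by lia⟩ : Fin n).val = 1 := rfl
  have hψ_ladder : IsLadder ψ 1 ε :=
    { toIsAlternating := hψ.toIsAlternating
      base := h.base_of_sameRadial hR hn hψ hacyclic hε₁ hm hmn hεm
      left_level := h.left_level_of_sameRadial hψ.toIsAlternating hR hε₁
      left_twin := fun {a u v} ha hu huv hl => by
        rcases eq_one_or_eq_neg_one_of_ne_zero (hε (u.val / 2)) with hεu | hεu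
        · exact (h.left_twin_of_sameRadial hψ.toIsAlternating hR (by lia) hε₁ ha hu huv hl
            hεu).trans hεu.symm
        · exact (h.twisted_twin_of_sameRadial hR hψ.toIsAlternating ha hb hu huv hl
            hεu).2.2.trans hεu.symm
      right := h.right_of_sameRadial hψ.toIsAlternating hR hn
      twin := fun hu huv hvw hl =>
        (h.twin_of_sameRadial hψ.toIsAlternating hR hn hb hu huv hvw hl).1
      level := fun hu huv hvw =>
        (h.right_level_of_sameRadial hψ.toIsAlternating hR hb hu huv hvw).2.2.2 }
  exact hψ_ladder.unique h

end Reconstruction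

theorem ncard_le_one (h : IsLadder χ 1 ε) (hn : 8 ≤ n) (hε₁ : ε 1 = 1) {m : ℕ} (hm : 1 ≤ m)
    (hmn : 2 * m + 1 < n) (hεm : ε m = -1) (hε : ∀ l, ε l ≠ 0) {R : RotationSystem n}
    (hR : IsRadialSystemOf χ R) : (T R).ncard ≤ 1 := by
  refine (Set.ncard_le_one (Set.toFinite _)).2 ?_
  rintro _ ⟨ψ₁, ⟨C₁, hC₁⟩, hψ₁, rfl⟩ _ ⟨ψ₂, ⟨C₂, hC₂⟩, hψ₂, rfl⟩
  have eq_ladder : ∀ {ψ C}, IsChirotopeOf C ψ → IsRadialSystemOf ψ R → ψ = χ := fun hC hψ =>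
    h.eq_of_sameRadial (hR.sameRadial hψ h.toIsAlternating hC.isUniform.toIsAlternating) hn
      hC.isUniform hC.isAcyclic hε₁ hm hmn hεm hε
  rw [eq_ladder hC₁ hψ₁, eq_ladder hC₂ hψ₂]

end IsLadder

/-! ### Flipping the base line -/

section Flip

variable {χ ψ : Chirotope n} {a b : Fin n} {s t : SignType}
  {ε δ : ℕ → SignType}

/-- The labels `a, b` lie on different sides of each line through two other points, and all other
points lie on the side `s` of the line from `a` to `b`. Moving that line across all other points
changes `s` but no cyclic order. -/
structure IsFlippable (χ : Chirotope n) (a b : Fin n) (s : SignType) : Prop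
    extends IsAlternating χ where
  ne : a ≠ b
  opposite : ∀ {u v}, u ≠ a → u ≠ b → v ≠ a → v ≠ b → χ b u v = -χ a u v
  base : ∀ {u}, u ≠ a → u ≠ b → χ a b u = s

theorem CcwAround.of_rot {i j k l c : Fin n} (h : CcwAround χ i j k l)
    (hc : c = j ∨ c = k ∨ c = l) (H : ∀ u v, CcwAround χ i c u v → CcwAround ψ i c u v) :
    CcwAround ψ i j k l := by
  rcases hc with rfl | rfl | rfl
  exacts [H _ _ h, (H _ _ h.rot).rot.rot, (H _ _ h.rot.rot).rot]

namespace IsFlippable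

theorem symm (h : IsFlippable χ a b s) : IsFlippable χ b a (-s) where
  toIsAlternating := h.toIsAlternating
  ne := h.ne.symm
  opposite hub hua hvb hva := by rw [h.opposite hua hub hva hvb, neg_neg]
  base hub hua := by rw [h.swap, h.base hua hub]

theorem ccwAround_left_iff (h : IsFlippable χ a b s) (hs : s ≠ 0) {u v : Fin n} (hua : u ≠ a)
    (hub : u ≠ b) (hva : v ≠ a) (hvb : v ≠ b) : CcwAround χ a b u v ↔ χ a u v = 1 := by
  rw [ccwAround_iff_twoPositive, h.base hua hub, h.rev a b v, h.base hva hvb]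
  generalize χ a u v = x
  clear h
  revert s x; decide

theorem ccwAround_outer_iff (h : IsFlippable χ a b s) {u v : Fin n} (hua : u ≠ a) (hub : u ≠ b)
    (hva : v ≠ a) (hvb : v ≠ b) : CcwAround χ u a b v ↔ χ a u v = 1 := by
  rw [ccwAround_iff_twoPositive, h.swap b u v, h.opposite hua hub hva hvb, neg_neg, h.rot a u v]
  tauto

end IsFlippable

theorem AgreeOff.symm (h : AgreeOff χ ψ a b) : AgreeOff χ ψ b a :=
  fun i j k hd => h i j k hd.symm

namespace AgreeOff

theorem ccwAround_left_of_isFlippable (h : AgreeOff χ ψ a b) (hχ : IsFlippable χ a b s)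
    (hψ : IsFlippable ψ a b t) (hs : s ≠ 0) (ht : t ≠ 0) {j k l : Fin n}
    (hc : CcwAround χ a j k l) : CcwAround ψ a j k l := by
  by_cases hb : b = j ∨ b = k ∨ b = l
  · refine hc.of_rot hb fun u v hc => ?_
    obtain ⟨hba, hua, hva⟩ := hc.ne hχ.toIsAlternating
    obtain ⟨hbu, hbv, -⟩ := hc.distinct3 hχ.toIsAlternating
    rw [hψ.ccwAround_left_iff ht hua hbu.symm hva hbv.symm, ← h a u v (by grind)]
    exact (hχ.ccwAround_left_iff hs hua hbu.symm hva hbv.symm).1 hc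
  · exact (h.ccwAround_iff (Or.inr (by have := hχ.ne; tauto))).1 hc

theorem ccwAround_outer_of_isFlippable (h : AgreeOff χ ψ a b) (hχ : IsFlippable χ a b s)
    (hψ : IsFlippable ψ a b t) {i v : Fin n} (hia : i ≠ a) (hib : i ≠ b)
    (hc : CcwAround χ i a b v) : CcwAround ψ i a b v := by
  obtain ⟨hab, hav, hbv⟩ := hc.distinct3 hχ.toIsAlternating
  rw [hψ.ccwAround_outer_iff hia hib hav.symm hbv.symm, ← h a i v (by grind)]
  exact (hχ.ccwAround_outer_iff hia hib hav.symm hbv.symm).1 hc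

theorem ccwAround_of_isFlippable (h : AgreeOff χ ψ a b) (hχ : IsFlippable χ a b s)
    (hψ : IsFlippable ψ a b t) (hs : s ≠ 0) (ht : t ≠ 0) {i j k l : Fin n}
    (hc : CcwAround χ i j k l) : CcwAround ψ i j k l := by
  have neg_ne_zero {r : SignType} : r ≠ 0 → -r ≠ 0 := by revert r; decide
  obtain rfl | hia := eq_or_ne i a
  · exact h.ccwAround_left_of_isFlippable hχ hψ hs ht hc
  obtain rfl | hib := eq_or_ne i b
  · exact h.symm.ccwAround_left_of_isFlippable hχ.symm hψ.symm (neg_ne_zero hs) (neg_ne_zero ht) hc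
  by_cases ha : a = j ∨ a = k ∨ a = l
  · refine hc.of_rot ha fun u v hc => ?_
    obtain rfl | hub := eq_or_ne u b
    · exact h.ccwAround_outer_of_isFlippable hχ hψ hia hib hc
    obtain rfl | hvb := eq_or_ne v b
    · exact (h.symm.ccwAround_outer_of_isFlippable hχ.symm hψ.symm hib hia hc.rot.rot).rot
    · exact (h.ccwAround_iff (Or.inr ⟨hib, hχ.ne, hub, hvb⟩)).1 hc
  · exact (h.ccwAround_iff (Or.inl (by tauto))).1 hc

theorem sameRadial_of_isFlippable (h : AgreeOff χ ψ a b) (hχ : IsFlippable χ a b s)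
    (hψ : IsFlippable ψ a b t) (hs : s ≠ 0) (ht : t ≠ 0) : SameRadial χ ψ := fun _ _ _ _ =>
  ⟨h.ccwAround_of_isFlippable hχ hψ hs ht,
    AgreeOff.ccwAround_of_isFlippable (fun i j k hd => (h i j k hd).symm) hψ hχ ht hs⟩

end AgreeOff

namespace IsLadder

theorem isFlippable (h : IsLadder χ s 1) (ha : a.val = 0) (hb : b.val = 1) :
    IsFlippable χ a b s where
  toIsAlternating := h.toIsAlternating
  ne := by lia
  base hua hub := h.base ha hb (by lia)
  opposite {u v} hua hub hva hvb := by
    have opposite_of_lt {u v : Fin n} (hu : 2 ≤ u.val) (huv : u < v) : χ b u v = -χ a u v := by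
      have left : χ a u v = 1 := by
        by_cases hl : u.val / 2 = v.val / 2
        · exact h.left_twin ha hu huv hl
        · exact h.left_level ha hu (by lia)
      rw [h.right hb hu huv, left]
    rcases lt_trichotomy u v with huv | rfl | hvu
    · exact opposite_of_lt (by lia) huv
    · rw [h.eq_zero (by simp [Distinct3]), h.eq_zero (by simp [Distinct3]), neg_zero]
    · rw [h.rev b v u, opposite_of_lt (by lia) hvu, h.rev a v u]

theorem mk_ne_mk (h : IsLadder χ 1 ε) (h' : IsLadder ψ (-1) δ) (hn : 5 ≤ n) :
    Quotient.mk (chirotopeSetoid n) χ ≠ Quotient.mk (chirotopeSetoid n) ψ := by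
  have one_ne_neg_one : (1 : SignType) ≠ -1 := by decide
  have base := h.base (a := ⟨0, by lia⟩) (b := ⟨1, by lia⟩) (u := ⟨2, by lia⟩) rfl rfl le_rfl
  have base' := h'.base (a := ⟨0, by lia⟩) (b := ⟨1, by lia⟩) (u := ⟨2, by lia⟩) rfl rfl le_rfl
  have left := h.left_level (a := ⟨0, by lia⟩) (u := ⟨2, by lia⟩) (v := ⟨4, by lia⟩) rfl le_rfl
    (by simp)
  have left' := h'.left_level (a := ⟨0, by lia⟩) (u := ⟨2, by lia⟩) (v := ⟨4, by lia⟩) rfl le_rfl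
    (by simp)
  intro he
  rcases Quotient.exact he with he | he
  · exact one_ne_neg_one (base.symm.trans ((he _ _ _).trans base'))
  · exact one_ne_neg_one (left.symm.trans ((he _ _ _).trans (congrArg _ left')))

theorem one_lt_ncard (h : IsLadder χ 1 1) (h' : IsLadder ψ (-1) 1) (hn : 5 ≤ n)
    (hχ : IsAbstractChirotope χ) (hψ : IsAbstractChirotope ψ) {R : RotationSystem n}
    (hR : IsRadialSystemOf χ R) : 1 < (T R).ncard := by
  have ha : (⟨0, by lia⟩ : Fin n).val = 0 := rfl
  have hb : (⟨1, by lia⟩ : Fin n).val = 1 := rfl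
  have same : SameRadial χ ψ := (h.agreeOff_base h' ha hb).sameRadial_of_isFlippable
    (h.isFlippable ha hb) (h'.isFlippable ha hb) (by decide) (by decide)
  exact (Set.one_lt_ncard (Set.toFinite _)).2
    ⟨_, ⟨χ, hχ, hR, rfl⟩, _, ⟨ψ, hψ, same.isRadialSystemOf hR, rfl⟩, h.mk_ne_mk h' hn⟩

end IsLadder

end Flip

/-! ### Realization of ladders -/

theorem generalPosition_of_isUniform (hn : 3 ≤ n) {p : Fin n → ℝ × ℝ}
    (h : IsUniform (pointChirotope p)) : GeneralPosition p := by
  refine ⟨fun i j hij => ?_, fun i j k hd => h.ne_zero i j k hd⟩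
  by_contra hne
  obtain ⟨k, -, hk⟩ : ∃ k ∈ Finset.univ, k ∉ ({i, j} : Finset (Fin n)) :=
    Finset.exists_mem_notMem_of_card_lt_card
      (Finset.card_le_two.trans_lt (by rw [Finset.card_univ, Fintype.card_fin]; exact hn))
  simp only [Finset.mem_insert, Finset.mem_singleton, not_or] at hk
  refine h.ne_zero i j k ⟨hne, Ne.symm hk.1, Ne.symm hk.2⟩ ?_
  rw [pointChirotope, hij, sub_self, sub_self, zero_mul, zero_mul, sub_self, sign_zero]

/-- The point of a parabola near which the two points at level `h` are placed. -/
def levelPoint (h : ℕ) : ℝ × ℝ :=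
  ((h : ℝ) ^ 2, (h : ℝ))

theorem area_left_levelPoint (p : ℝ × ℝ) (g h : ℕ) : area p (levelPoint g) (levelPoint h) =
    ((h : ℝ) - g) * (p.2 * (g + h) - g * h - p.1) := by
  simp only [area, levelPoint]
  ring

theorem area_levelPoint (f g h : ℕ) : area (levelPoint f) (levelPoint g) (levelPoint h) =
    ((g : ℝ) - f) * (h - f) * (g - h) := by
  simp only [area, levelPoint]
  ring

theorem area_levelPoint_add (p v : ℝ × ℝ) (h : ℕ) :
    area (levelPoint h) (levelPoint h + v) p = v.1 * (p.2 - h) - v.2 * (p.1 - h ^ 2) := by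
  simp only [area, levelPoint, Prod.fst_add, Prod.snd_add]
  ring

theorem area_levelPoint_add_levelPoint (v : ℝ × ℝ) (g h : ℕ) :
    area (levelPoint h) (levelPoint h + v) (levelPoint g) =
      (v.1 - v.2 * ((g : ℝ) + h)) * (g - h) := by
  rw [area_levelPoint_add, levelPoint]
  ring

/-- A point `a` for label `0`, a point `b` for label `1`, and directions `d h` for the connecting
lines of the two points at each level `h`, in such a position that two points at distance of order
`e` for each level give a ladder when `e` is small. The field `slope` says that the line through
`levelPoint h` in direction `d h` crosses the parabola there and separates the levels below from
those above. -/
structure IsLadderFrame (n : ℕ) (a b : ℝ × ℝ) (d : ℕ → ℝ × ℝ) (s : SignType)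
    (ε : ℕ → SignType) : Prop where
  base : ∀ {h : ℕ}, 1 ≤ h → h < n → SignType.sign (area a b (levelPoint h)) = s
  left : ∀ {g h : ℕ}, 1 ≤ g → g < h → h < n → 0 < area a (levelPoint g) (levelPoint h)
  right : ∀ {g h : ℕ}, 1 ≤ g → g < h → h < n → area b (levelPoint g) (levelPoint h) < 0
  left_twin : ∀ {h : ℕ}, 1 ≤ h → h < n →
    SignType.sign (area (levelPoint h) (levelPoint h + d h) a) = ε h
  right_twin : ∀ {h : ℕ}, 1 ≤ h → h < n → area (levelPoint h) (levelPoint h + d h) b < 0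
  slope : ∀ {g h : ℕ}, 1 ≤ g → g < n → 1 ≤ h → h < n → (d h).2 * ((g : ℝ) + h) < (d h).1

/-- The points of a ladder: `a`, `b`, and at each level two points that differ by `e` times the
direction `d` of the level. -/
noncomputable def ladderPoints (a b : ℝ × ℝ) (d : ℕ → ℝ × ℝ) (e : ℝ) (i : Fin n) : ℝ × ℝ :=
  if i.val = 0 then a else if i.val = 1 then b else
    levelPoint (i.val / 2) + (e * (i.val % 2 : ℕ)) • d (i.val / 2)

section LadderPoints

variable {a b : ℝ × ℝ} {d : ℕ → ℝ × ℝ} {s σ : SignType} {ε : ℕ → SignType} {e : ℝ}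
  {i j k u v w : Fin n}

theorem ladderPoints_left (hi : i.val = 0) : ladderPoints a b d e i = a :=
  if_pos hi

theorem ladderPoints_right (hi : i.val = 1) : ladderPoints a b d e i = b := by
  rw [ladderPoints, if_neg (by lia), if_pos hi]

theorem ladderPoints_level (hi : 2 ≤ i.val) : ladderPoints a b d e i =
    levelPoint (i.val / 2) + (e * (i.val % 2 : ℕ)) • d (i.val / 2) := by
  rw [ladderPoints, if_neg (by lia), if_neg (by lia)]

theorem ladderPoints_level_zero (hi : 2 ≤ i.val) :
    ladderPoints a b d 0 i = levelPoint (i.val / 2) := by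
  rw [ladderPoints_level hi, zero_mul, zero_smul, add_zero]

theorem continuous_ladderPoints (i : Fin n) : Continuous fun e => ladderPoints a b d e i := by
  unfold ladderPoints
  split_ifs <;> fun_prop

theorem area_add_smul (p q v : ℝ × ℝ) (e : ℝ) : area p q (q + e • v) = e * area q (q + v) p := by
  simp only [area, Prod.fst_add, Prod.snd_add, Prod.smul_fst, Prod.smul_snd, smul_eq_mul]
  ring

theorem area_ladderPoints_twin (hu : 2 ≤ u.val) (huv : u < v) (hl : u.val / 2 = v.val / 2)
    (p : ℝ × ℝ) : area p (ladderPoints a b d e u) (ladderPoints a b d e v) =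
      e * area (levelPoint (u.val / 2)) (levelPoint (u.val / 2) + d (u.val / 2)) p := by
  rw [ladderPoints_level hu, ladderPoints_level (by lia), ← hl, show u.val % 2 = 0 by lia,
    show v.val % 2 = 1 by lia, Nat.cast_zero, mul_zero, zero_smul, add_zero, Nat.cast_one, mul_one,
    area_add_smul]

theorem eventually_pointChirotope_of_limit (hσ : σ ≠ 0) (h : SignType.sign (area
      (ladderPoints a b d 0 i) (ladderPoints a b d 0 j) (ladderPoints a b d 0 k)) = σ) :
    ∀ᶠ e in 𝓝[>] 0, pointChirotope (ladderPoints a b d e) i j k = σ := by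
  have hcont : Continuous fun e => area (ladderPoints a b d e i) (ladderPoints a b d e j)
      (ladderPoints a b d e k) := by
    have := continuous_ladderPoints (a := a) (b := b) (d := d) (n := n)
    unfold area
    fun_prop
  filter_upwards [nhdsWithin_le_nhds
    (eventually_sign_eq hcont.continuousAt (sign_ne_zero.1 (h ▸ hσ)))] with e he
  rw [pointChirotope_eq_sign_area, he, h]

theorem eventually_pointChirotope_twin (hu : 2 ≤ u.val) (huv : u < v)
    (hl : u.val / 2 = v.val / 2) (hσ : σ ≠ 0) (h : SignType.sign (area (levelPoint (u.val / 2))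
      (levelPoint (u.val / 2) + d (u.val / 2)) (ladderPoints a b d 0 w)) = σ) :
    ∀ᶠ e in 𝓝[>] 0, pointChirotope (ladderPoints a b d e) w u v = σ := by
  have hcont : Continuous fun e => area (levelPoint (u.val / 2))
      (levelPoint (u.val / 2) + d (u.val / 2)) (ladderPoints a b d e w) := by
    have := continuous_ladderPoints (a := a) (b := b) (d := d) w
    unfold area
    fun_prop
  filter_upwards [self_mem_nhdsWithin, nhdsWithin_le_nhds
    (eventually_sign_eq hcont.continuousAt (sign_ne_zero.1 (h ▸ hσ)))] with e hpos he
  rw [pointChirotope_eq_sign_area, area_ladderPoints_twin hu huv hl, sign_mul, sign_pos hpos,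
    one_mul, he, h]

end LadderPoints

namespace IsLadderFrame

variable {a b : ℝ × ℝ} {d : ℕ → ℝ × ℝ} {s : SignType} {ε : ℕ → SignType} {u v w i j k : Fin n}

variable (hF : IsLadderFrame n a b d s ε)
include hF

theorem eventually_twin (hu : 2 ≤ u.val) (huv : u < v) (hvw : v < w)
    (hl : u.val / 2 = v.val / 2) :
    ∀ᶠ e in 𝓝[>] 0, pointChirotope (ladderPoints a b d e) u v w = 1 := by
  have hlt : ((u.val / 2 : ℕ) : ℝ) < (w.val / 2 : ℕ) := by
    exact_mod_cast (by lia : u.val / 2 < w.val / 2)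
  simp only [fun e => (isAlternating_pointChirotope (ladderPoints a b d e)).rot w u v]
  refine eventually_pointChirotope_twin hu huv hl (by decide) ?_
  rw [ladderPoints_level_zero (by lia), area_levelPoint_add_levelPoint]
  exact sign_pos (mul_pos (sub_pos.2 (hF.slope (by lia) (by lia) (by lia) (by lia)))
    (sub_pos.2 hlt))

theorem eventually_level (hu : 2 ≤ u.val) (huv : u.val / 2 < v.val / 2) (hvw : v < w) :
    ∀ᶠ e in 𝓝[>] 0, pointChirotope (ladderPoints a b d e) u v w = -1 := by
  have hlt : ((u.val / 2 : ℕ) : ℝ) < (v.val / 2 : ℕ) := by exact_mod_cast huv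
  by_cases hl : v.val / 2 = w.val / 2
  · refine eventually_pointChirotope_twin (by lia) hvw hl (by decide) ?_
    rw [ladderPoints_level_zero hu, area_levelPoint_add_levelPoint]
    exact sign_neg (mul_neg_of_pos_of_neg
      (sub_pos.2 (hF.slope (by lia) (by lia) (by lia) (by lia))) (sub_neg.2 hlt))
  · have hlt' : ((v.val / 2 : ℕ) : ℝ) < (w.val / 2 : ℕ) := by
      exact_mod_cast (by lia : v.val / 2 < w.val / 2)
    refine eventually_pointChirotope_of_limit (by decide) ?_
    rw [ladderPoints_level_zero hu, ladderPoints_level_zero (by lia),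
      ladderPoints_level_zero (by lia), area_levelPoint]
    exact sign_neg (mul_neg_of_pos_of_neg
      (mul_pos (sub_pos.2 hlt) (sub_pos.2 (hlt.trans hlt'))) (sub_neg.2 hlt'))

theorem eventually_right (hi : i.val = 1) (hu : 2 ≤ u.val) (huv : u < v) :
    ∀ᶠ e in 𝓝[>] 0, pointChirotope (ladderPoints a b d e) i u v = -1 := by
  by_cases hl : u.val / 2 = v.val / 2
  · refine eventually_pointChirotope_twin hu huv hl (by decide) ?_
    rw [ladderPoints_right hi]
    exact sign_neg (hF.right_twin (by lia) (by lia))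
  · refine eventually_pointChirotope_of_limit (by decide) ?_
    rw [ladderPoints_right hi, ladderPoints_level_zero hu, ladderPoints_level_zero (by lia)]
    exact sign_neg (hF.right (by lia) (by lia) (by lia))

variable (hε : ∀ l, ε l ≠ 0)
include hε

theorem eventually_left (hi : i.val = 0) (hu : 2 ≤ u.val) (huv : u < v) :
    ∀ᶠ e in 𝓝[>] 0, pointChirotope (ladderPoints a b d e) i u v =
      if u.val / 2 = v.val / 2 then ε (u.val / 2) else 1 := by
  split_ifs with hl
  · refine eventually_pointChirotope_twin hu huv hl (hε _) ?_
    rw [ladderPoints_left hi]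
    exact hF.left_twin (by lia) (by lia)
  · refine eventually_pointChirotope_of_limit (by decide) ?_
    rw [ladderPoints_left hi, ladderPoints_level_zero hu, ladderPoints_level_zero (by lia)]
    exact sign_pos (hF.left (by lia) (by lia) (by lia))

variable (hs : s ≠ 0)
include hs

theorem eventually_eq_ladderSign (hij : i < j) (hjk : j < k) :
    ∀ᶠ e in 𝓝[>] 0, pointChirotope (ladderPoints a b d e) i j k = ladderSign s ε i j k := by
  unfold ladderSign
  by_cases hi₀ : i.val = 0
  · by_cases hj : j.val = 1
    · simp only [hi₀, hj, if_true]
      refine eventually_pointChirotope_of_limit hs ?_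
      rw [ladderPoints_left hi₀, ladderPoints_right hj, ladderPoints_level_zero (by lia)]
      exact hF.base (by lia) (by lia)
    · simpa only [hi₀, hj, if_true, if_false] using hF.eventually_left hε hi₀ (by lia) hjk
  · by_cases hi₁ : i.val = 1
    · simpa only [hi₁, one_ne_zero, if_true, if_false] using hF.eventually_right hi₁ (by lia) hjk
    · simp only [hi₀, hi₁, if_false]
      split_ifs with hl
      exacts [hF.eventually_twin (by lia) hij hjk hl, hF.eventually_level (by lia) (by lia) hjk]

theorem exists_isLadder (hn : 3 ≤ n) :
    ∃ p : Fin n → ℝ × ℝ, GeneralPosition p ∧ IsLadder (pointChirotope p) s ε := by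
  have eventually_eq : ∀ᶠ e in 𝓝[>] 0, ∀ i j k : Fin n, i < j → j < k →
      pointChirotope (ladderPoints a b d e) i j k = ladderSign s ε i j k := by
    simp only [eventually_all]
    exact fun i j k => hF.eventually_eq_ladderSign hε hs
  obtain ⟨e, he⟩ := eventually_eq.exists
  have ladder := (isAlternating_pointChirotope _).isLadder_of_sorted he
  exact ⟨_, generalPosition_of_isUniform hn (ladder.isUniform hs hε), ladder⟩

end IsLadderFrame

section SignType

variable {α : Type*} [Ring α] [LinearOrder α] [IsStrictOrderedRing α]

theorem sign_coe_signType (σ : SignType) : SignType.sign (σ : α) = σ := by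
  cases σ <;> simp

theorem coe_signType_le_one (σ : SignType) : (σ : α) ≤ 1 := by
  cases σ <;> simp

end SignType

theorem area_horizontal_levelPoint (x x' y : ℝ) (h : ℕ) :
    area (x, y) (x', y) (levelPoint h) = (x' - x) * (h - y) := by
  simp only [area, levelPoint]
  ring

/-- The direction at level `h` is the direction from the left point to `levelPoint h`, turned by a
small angle in the sense given by `ε h`. -/
theorem isLadderFrame_below (n : ℕ) (ε : ℕ → SignType) :
    IsLadderFrame n (-(4 * (n : ℝ) ^ 2), -1) (1, -1)
      (fun h => ((h : ℝ) ^ 2 + 4 * (n : ℝ) ^ 2, (h : ℝ) + 1 + (ε h : ℝ))) 1 ε where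
  base {h} h₁ _ := by
    rw [area_horizontal_levelPoint, sub_neg_eq_add, sub_neg_eq_add]
    exact sign_pos (by positivity)
  left {g h} g₁ hgh hn := by
    have hg : (1 : ℝ) ≤ g := by exact_mod_cast g₁
    have hgh : (g : ℝ) < h := by exact_mod_cast hgh
    have hn : (h : ℝ) + 1 ≤ n := by exact_mod_cast hn
    rw [area_left_levelPoint]
    exact mul_pos (by linarith) (by nlinarith)
  right {g h} _ hgh _ := by
    have hgh : (g : ℝ) < h := by exact_mod_cast hgh
    rw [area_left_levelPoint]
    have : (0 : ℝ) < (g + 1) * (h + 1) := by positivity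
    exact mul_neg_of_pos_of_neg (by linarith) (by linarith)
  left_twin {h} h₁ _ := by
    have : ((h : ℝ) ^ 2 + 4 * (n : ℝ) ^ 2) * (-1 - h) -
        ((h : ℝ) + 1 + (ε h : ℝ)) * (-(4 * (n : ℝ) ^ 2) - h ^ 2) =
        ((h : ℝ) ^ 2 + 4 * (n : ℝ) ^ 2) * (ε h : ℝ) := by
      ring
    rw [area_levelPoint_add, this, sign_mul, sign_pos (by positivity), one_mul,
      sign_coe_signType]
  right_twin {h} h₁ hn := by
    have hh : (1 : ℝ) ≤ h := by exact_mod_cast h₁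
    have hn : (h : ℝ) + 1 ≤ n := by exact_mod_cast hn
    have : ((h : ℝ) ^ 2 + 4 * (n : ℝ) ^ 2) * (-1 - h) -
        ((h : ℝ) + 1 + (ε h : ℝ)) * (1 - h ^ 2) =
        ((h : ℝ) + 1) * ((ε h : ℝ) * (h - 1) - (4 * (n : ℝ) ^ 2 + 1)) := by
      ring
    rw [area_levelPoint_add, this]
    refine mul_neg_of_pos_of_neg (by positivity) ?_
    nlinarith [coe_signType_le_one (α := ℝ) (ε h)]
  slope {g h} _ hg h₁ hh := by
    have hh₁ : (1 : ℝ) ≤ h := by exact_mod_cast h₁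
    have hg : (g : ℝ) + 1 ≤ n := by exact_mod_cast hg
    have hh : (h : ℝ) + 1 ≤ n := by exact_mod_cast hh
    have hε := coe_signType_le_one (α := ℝ) (ε h)
    calc ((h : ℝ) + 1 + (ε h : ℝ)) * (g + h) ≤ ((h : ℝ) + 2) * (g + h) :=
        mul_le_mul_of_nonneg_right (by linarith) (by positivity)
      _ < (h : ℝ) ^ 2 + 4 * (n : ℝ) ^ 2 := by nlinarith

theorem isLadderFrame_above (n : ℕ) :
    IsLadderFrame n (-(n : ℝ) ^ 2, n) (4 * (n : ℝ) ^ 2, n) (fun _ => (2 * (n : ℝ), 1)) (-1) 1 where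
  base {h} h₁ hn := by
    have h₁ : (1 : ℝ) ≤ h := by exact_mod_cast h₁
    have hn : (h : ℝ) + 1 ≤ n := by exact_mod_cast hn
    rw [area_horizontal_levelPoint]
    exact sign_neg (mul_neg_of_pos_of_neg (by nlinarith) (by linarith))
  left {g h} _ hgh hn := by
    have hgh : (g : ℝ) < h := by exact_mod_cast hgh
    have hn : (h : ℝ) + 1 ≤ n := by exact_mod_cast hn
    rw [area_left_levelPoint]
    exact mul_pos (by linarith) (by nlinarith)
  right {g h} _ hgh hn := by
    have hgh : (g : ℝ) < h := by exact_mod_cast hgh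
    have hn : (h : ℝ) + 1 ≤ n := by exact_mod_cast hn
    rw [area_left_levelPoint]
    exact mul_neg_of_pos_of_neg (by linarith) (by nlinarith)
  left_twin {h} _ hn := by
    have hn : (h : ℝ) + 1 ≤ n := by exact_mod_cast hn
    rw [area_levelPoint_add]
    exact sign_pos (by nlinarith)
  right_twin {h} _ hn := by
    have hn : (h : ℝ) + 1 ≤ n := by exact_mod_cast hn
    rw [area_levelPoint_add]
    nlinarith
  slope {g h} _ hg _ hh := by
    have hg : (g : ℝ) + 1 ≤ n := by exact_mod_cast hg
    have hh : (h : ℝ) + 1 ≤ n := by exact_mod_cast hh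
    dsimp only
    linarith

/-! ### The lower bound -/

theorem exists_isLadder_one_lt_ncard (hn : 5 ≤ n) :
    ∃ (p : Fin n → ℝ × ℝ) (R : RotationSystem n), GeneralPosition p ∧
      IsLadder (pointChirotope p) 1 1 ∧ IsRadialSystemOf (pointChirotope p) R ∧
      1 < (T R).ncard := by
  have one_ne_zero : (1 : SignType) ≠ 0 := by decide
  obtain ⟨p, hp, hbelow⟩ :=
    (isLadderFrame_below n 1).exists_isLadder (fun _ => one_ne_zero) one_ne_zero (by omega)
  obtain ⟨p', hp', habove⟩ :=
    (isLadderFrame_above n).exists_isLadder (fun _ => one_ne_zero) (by decide) (by omega)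
  obtain ⟨R, hR⟩ := hp.exists_isRadialSystemOf
  exact ⟨p, R, hp, hbelow, hR,
    hbelow.one_lt_ncard habove hn hp.isAbstractChirotope hp'.isAbstractChirotope hR⟩

theorem IsLadder.exists_ncard_le_one {χ : Chirotope n} (h : IsLadder χ 1 1) {R : RotationSystem n}
    (hR : IsRadialSystemOf χ R) (hn : 8 ≤ n) {m : ℕ} (hm : 2 ≤ m) (hmn : 2 * m + 1 < n) :
    ∃ S : RotationSystem n, IsOrderTypeRadialSystem S ∧ (T S).ncard ≤ 1 ∧
      ∀ q : Query n, m ∉ q.touched R → q.answer R = q.answer S := by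
  set ε : ℕ → SignType := Function.update 1 m (-1)
  have hε (l : ℕ) : ε l ≠ 0 := by
    rcases eq_or_ne l m with rfl | hl
    · simp [ε]
    · simp [ε, hl]
  have hε₁ : ε 1 = 1 := Function.update_of_ne (by omega) _ _
  have hεm : ε m = -1 := Function.update_self _ _ _
  obtain ⟨p, hp, hladder⟩ :=
    (isLadderFrame_below n ε).exists_isLadder hε (by decide) (by omega)
  obtain ⟨S, hS⟩ := hp.exists_isRadialSystemOf
  have hagree : AgreeOff χ (pointChirotope p) ⟨2 * m, by omega⟩ ⟨2 * m + 1, hmn⟩ :=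
    h.agreeOff_twin hladder (fun l hl => (Function.update_of_ne hl _ _).symm) rfl rfl
  refine ⟨S, ⟨p, hp, hS⟩, hladder.ncard_le_one hn hε₁ (by omega) hmn hεm hε hS, fun q hq => ?_⟩
  exact Query.answer_eq_of_agreeOff (by simp) (by simp; omega) (by simp) hagree h.toIsAlternating
    hladder.toIsAlternating hR hS hq

end RadialSystems


theorem mainTheorem6 :
    ∃ c : ℝ, 0 < c ∧ ∃ N : ℕ, ∀ n : ℕ, N ≤ n →
      ∀ A : RadialSystems.Algorithm n, A.DeterminesCard →
        ∃ R : RadialSystems.RotationSystem n, RadialSystems.IsOrderTypeRadialSystem R ∧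
          c * (n : ℝ) ≤ (A.numQueries R : ℝ) := by
  refine ⟨1 / 16, by norm_num, 16, fun n hn A hA => ?_⟩
  obtain ⟨p, R, hp, hladder, hR, hcard⟩ :=
    RadialSystems.exists_isLadder_one_lt_ncard (n := n) (by omega)
  have hR' : RadialSystems.IsOrderTypeRadialSystem R := ⟨p, hp, hR⟩
  have hblocks : (Finset.Ico 2 (n / 2)).card ≤ 4 * A.numQueries R := by
    refine A.card_le_four_mul_numQueries fun m hm => ?_
    obtain ⟨hm₂, hmn⟩ := Finset.mem_Ico.1 hm
    obtain ⟨S, hS, hS₁, hagree⟩ := hladder.exists_ncard_le_one hR (by omega) hm₂ (by omega)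
    refine ⟨S, fun hrun => ?_, hagree⟩
    rw [hA S hS, hA R hR'] at hrun
    omega
  rw [Nat.card_Ico] at hblocks
  have hn' : (n : ℝ) ≤ 16 * A.numQueries R := by
    have : n ≤ 16 * A.numQueries R := by omega
    exact_mod_cast this
  exact ⟨R, hR', by linarith⟩
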